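/- Let $f:\mathbb R^d\to\mathbb R$ be convex and $L$-smooth (differentiable with $L$-Lipschitz gradient), let $\hat L\ge L$, $\hat L>0$, $\gamma_0>0$, let $0\le s<q\le d$ and $T\ge 0$ be integers, let $\theta_0\in\mathbb R^d$, and let $\theta^*$ be a minimizer of $f$ over $\mathbb R^d\setminus\{0\}$ (for instance a global minimizer). Put $a=\frac{2(q-s-1)+\pi}{(d-s)\pi}$. The idealized (P)ARS-OPT algorithm (ARS-OPT if $s=0$) starts from $\theta_0$, $m_0=\theta_0$, $\gamma_0$. At iteration $t=0,\dots,T-1$ it takes $s$ prior vectors $k_{t,1},\dots,k_{t,s}$, almost surely linearly independent and depending measurably on the history before iteration $t$, draws $r_{t,1},\dots,r_{t,q-s}$ i.i.d. from $\mathcal N(0,I_d)$ independently of that history, and lets $p_{t,1},\dots,p_{t,s},u_{t,1},\dots,u_{t,q-s}$ be the Gram–Schmidt orthonormalization of $k_{t,1},\dots,k_{t,s},r_{t,1},\dots,r_{t,q-s}$. With a history-dependent step size $\zeta_t>0$ it sets $\tilde\theta_t=(1-\alpha_t)\theta_t+\alpha_t m_t$, where $\alpha_t>0$ and $\alpha_t^2=\zeta_t\gamma_t(1-\alpha_t)$,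 and $\gamma_{t+1}=(1-\alpha_t)\gamma_t$. Here, with $D_t=\sum_{i=1}^s(\nabla f(\tilde\theta_t)^\top p_{t,i})^2/\|\nabla f(\tilde\theta_t)\|^2$ (and $D_t=0$ if $\nabla f(\tilde\theta_t)=0$), the step size satisfies $$\zeta_t\le\bar\zeta_t:=\frac{D_t+a(1-D_t)}{\hat L\,\bigl(D_t+a^{-1}(1-D_t)\bigr)}.$$ Finally, with $v_t=\frac1{\sqrt{q-s}}\sum_{j=1}^{q-s}\operatorname{sign}(\nabla f(\tilde\theta_t)^\top u_{t,j})\,u_{t,j}$, it sets $$\theta_{t+1}=\tilde\theta_t-\tfrac1{\hat L}\Bigl(\nabla f(\tilde\theta_t)^\top v_t\, v_t+\sum_{i=1}^s\nabla f(\tilde\theta_t)^\top p_{t,i}\,p_{t,i}\Bigr),\qquad m_{t+1}=m_t-\tfrac{\zeta_t}{\alpha_t}\Bigl(\tfrac{1}{a}\,\nabla f(\tilde\theta_t)^\top v_t\,v_t+\sum_{i=1}^s\nabla f(\tilde\theta_t)^\top p_{t,i}\,p_{t,i}\Bigr).$$ Then the random variable below is integrable and $$\mathbb E\Bigl[(f(\theta_T)-f(\theta^*))\Bigl(1+\tfrac{\sqrt{\gamma_0}}2\sum_{t=0}^{T-1}\sqrt{\zeta_t}\Bigr)^2\Bigr]\le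 f(\theta_0)-f(\theta^*)+\tfrac{\gamma_0}2\|\theta_0-\theta^*\|^2 .$$ Moreover $\bar\zeta_t\ge a^2/\hat L$ for every $t<T$, and for every constant $c>0$ such that $\zeta_t\ge c$ almost surely for all $t<T$ (for instance $c=a^2/\hat L$ when $\zeta_t=\bar\zeta_t$), $f(\theta_T)-f(\theta^*)$ is integrable and the rate is $O(1/T^2)$: $$\mathbb E[f(\theta_T)-f(\theta^*)]\le\frac{f(\theta_0)-f(\theta^*)+\frac{\gamma_0}2\|\theta_0-\theta^*\|^2}{\bigl(1+\frac{\sqrt{\gamma_0}}2\,T\sqrt c\bigr)^2}.$$ -/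

import Mathlib

open MeasureTheory ProbabilityTheory InnerProductSpace

noncomputable section

namespace ARSOpt

/-- `ℝ^d` with the Euclidean norm. -/
abbrev Vec (d : ℕ) : Type := EuclideanSpace ℝ (Fin d)

/-- `f` is `L`-smooth: it is differentiable and its gradient is `L`-Lipschitz. -/
def IsSmooth {d : ℕ} (f : Vec d → ℝ) (L : ℝ) : Prop :=
  Differentiable ℝ f ∧ ∀ x y : Vec d, ‖gradient f x - gradient f y‖ ≤ L * ‖x - y‖

section Estimators

variable {d s m : ℕ}

/-- The normalised prior directions `p₁, …, pₛ`: the first `s` vectors of the Gram–Schmidt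
orthonormalisation of `k₁, …, kₛ, r₁, …, rₘ`. -/
def priorDir (k : Fin s → Vec d) (r : Fin m → Vec d) (i : Fin s) : Vec d :=
  gramSchmidtNormed ℝ (Fin.append k r) (Fin.castAdd m i)

/-- The random directions `u₁, …, uₘ`: the last `m` vectors of the Gram–Schmidt
orthonormalisation of `k₁, …, kₛ, r₁, …, rₘ`. -/
def randDir (k : Fin s → Vec d) (r : Fin m → Vec d) (j : Fin m) : Vec d :=
  gramSchmidtNormed ℝ (Fin.append k r) (Fin.natAdd s j)

/-- The sign-based direction `v = m^{-1/2} ∑ⱼ sign(gᵀuⱼ) uⱼ`, where `g` is the gradient. -/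
def signDir (g : Vec d) (k : Fin s → Vec d) (r : Fin m → Vec d) : Vec d :=
  (1 / Real.sqrt m) • ∑ j, Real.sign (inner ℝ g (randDir k r j)) • randDir k r j

/-- The component `∑ᵢ (gᵀpᵢ) pᵢ` of the gradient `g` along the priors. -/
def priorPart (g : Vec d) (k : Fin s → Vec d) (r : Fin m → Vec d) : Vec d :=
  ∑ i, inner ℝ g (priorDir k r i) • priorDir k r i

/-- `g₁ = (gᵀv) v + ∑ᵢ (gᵀpᵢ) pᵢ`. -/
def gradEst₁ (g : Vec d) (k : Fin s → Vec d) (r : Fin m → Vec d) : Vec d :=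
  inner ℝ g (signDir g k r) • signDir g k r + priorPart g k r

/-- The constant `(2 (q - s - 1) + π) / ((d - s) π)`. -/
def signConst (d q s : ℕ) : ℝ :=
  (2 * ((q : ℝ) - s - 1) + Real.pi) / (((d : ℝ) - s) * Real.pi)

/-- `g₂ = (d - s) / ((2/π) (q - s - 1) + 1) (gᵀv) v + ∑ᵢ (gᵀpᵢ) pᵢ`, with `m = q - s` random
vectors. -/
def gradEst₂ (q : ℕ) (g : Vec d) (k : Fin s → Vec d) (r : Fin m → Vec d) : Vec d :=
  (((d : ℝ) - s) / (2 / Real.pi * ((q : ℝ) - s - 1) + 1) * inner ℝ g (signDir g k r)) •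
      signDir g k r + priorPart g k r

/-- The quality `D = ∑ᵢ (gᵀpᵢ)² / ‖g‖²` of the priors (it is `0` when `g = 0`). -/
def priorQuality (g : Vec d) (k : Fin s → Vec d) (r : Fin m → Vec d) : ℝ :=
  (∑ i, inner ℝ g (priorDir k r i) ^ 2) / ‖g‖ ^ 2

/-- The step size
`(D + a (1 - D)) / (Lhat (D + a⁻¹ (1 - D)))` with `a = (2 (q - s - 1) + π) / ((d - s) π)`. -/
def stepSize (Lhat : ℝ) (d q s : ℕ) (D : ℝ) : ℝ :=
  (D + signConst d q s * (1 - D)) / (Lhat * (D + (signConst d q s)⁻¹ * (1 - D)))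

end Estimators

/-- A run of `T` iterations of idealised (P)ARS-OPT on `f : ℝ^d → ℝ`, started at `θ₀`, with `q`
estimation vectors, `s` of which come from priors (`s = 0` is ARS-OPT), on the probability space
`(Ω, μ)`. Idealised: exact derivatives replace finite differences, the prior quality is the exact
one at the lookahead point, and there is no clipping. `ℱ t` is the information available before
the random vectors of iteration `t` are drawn. -/
structure IdealizedRun {d : ℕ} {Ω : Type*} {mΩ : MeasurableSpace Ω} (μ : Measure Ω)
    (f : Vec d → ℝ) (θ₀ : Vec d) (Lhat γ₀ : ℝ) (q s T : ℕ) where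
  /-- the history -/
  ℱ : Filtration ℕ mΩ
  /-- the priors -/
  k : ℕ → Ω → Fin s → Vec d
  /-- the random vectors -/
  r : ℕ → Ω → Fin (q - s) → Vec d
  /-- the main sequence -/
  θ : ℕ → Ω → Vec d
  /-- the lookahead points -/
  θtilde : ℕ → Ω → Vec d
  /-- the auxiliary (momentum) sequence -/
  m : ℕ → Ω → Vec d
  /-- the step sizes -/
  ζ : ℕ → Ω → ℝ
  /-- the interpolation coefficients -/
  α : ℕ → Ω → ℝ
  /-- the scalars `γ` -/
  γ : ℕ → Ω → ℝ
  θ_zero : ∀ ω, θ 0 ω = θ₀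
  m_zero : ∀ ω, m 0 ω = θ₀
  γ_zero : ∀ ω, γ 0 ω = γ₀
  /-- the priors are chosen from the history -/
  k_measurable : ∀ t < T, Measurable[ℱ t] (k t)
  /-- the priors can be orthonormalised -/
  k_linearIndependent : ∀ t < T, ∀ᵐ ω ∂μ, LinearIndependent ℝ (k t ω)
  r_measurable : ∀ t < T, Measurable[ℱ (t + 1)] (r t)
  /-- the random vectors are i.i.d. standard Gaussian … -/
  r_law : ∀ t < T, μ.map (r t) = Measure.pi (fun _ => stdGaussian (Vec d))
  /-- … and fresh -/
  r_indep : ∀ t < T, Indep (MeasurableSpace.comap (r t) inferInstance) (ℱ t) μ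
  /-- the step sizes are chosen from the history -/
  ζ_measurable : ∀ t < T, Measurable[ℱ t] (ζ t)
  ζ_pos : ∀ t < T, ∀ ω, 0 < ζ t ω
  ζ_le : ∀ t < T, ∀ ω, ζ t ω ≤
    stepSize Lhat d q s (priorQuality (gradient f (θtilde t ω)) (k t ω) (r t ω))
  α_pos : ∀ t < T, ∀ ω, 0 < α t ω
  α_root : ∀ t < T, ∀ ω, α t ω ^ 2 = ζ t ω * γ t ω * (1 - α t ω)
  θtilde_eq : ∀ t < T, ∀ ω, θtilde t ω = (1 - α t ω) • θ t ω + α t ω • m t ω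
  γ_succ : ∀ t < T, ∀ ω, γ (t + 1) ω = (1 - α t ω) * γ t ω
  θ_succ : ∀ t < T, ∀ ω, θ (t + 1) ω =
    θtilde t ω - (1 / Lhat) • gradEst₁ (gradient f (θtilde t ω)) (k t ω) (r t ω)
  m_succ : ∀ t < T, ∀ ω, m (t + 1) ω =
    m t ω - (ζ t ω / α t ω) • gradEst₂ q (gradient f (θtilde t ω)) (k t ω) (r t ω)

end ARSOpt

end

/-! The potential `(f θ_t - f θ⋆) / γ_t + ‖m_t - θ⋆‖² / 2` does not increase in expectation, and
`γ_T` decays fast enough to turn this into a rate.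

One step rests on the second moments of `v`: with the priors frozen and `r` Gaussian, `E[(gᵀv)(wᵀv)]
= a ⟪g', w'⟫`, where `'` is the component orthogonal to the priors (`integral_inner_signDir_mul`).
Reflections fixing the priors preserve the Gaussian law, which makes this form a multiple of the
inner product; averaging also over a Gaussian `g` identifies `a`. Hence the second estimator is
unbiased, with second moment at most `a⁻¹‖g'‖² + S`, where `S = ∑ᵢ (gᵀpᵢ)²`, while the step along
the first one lowers `f` by at least `(a‖g'‖² + S) / (2 Lhat)` in expectation. The step-size rule
says exactly that this decrease pays for the second-moment term. What remains is linear in `g`, and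
convexity at the lookahead point, tested against `θ_t` and `θ⋆`, absorbs it
(`lintegral_nextPotential_le`).

Freshness of the draws transfers the bound to the run (`lintegral_potential_succ_le`). Pathwise,
`1/√γ` grows by at least `√ζ / 2` per step (`inv_sqrt_add_le`), so the squared weight is at most `γ₀
/ γ_T`. Lower integrals of nonnegative functions are used along the run, so integrability comes out
at the end. -/

noncomputable section

namespace ARSOpt

/-! ### Gram–Schmidt: equivariance, prefixes and Bessel bounds. -/

section GramSchmidt

variable {E : Type*} [NormedAddCommGroup E] [InnerProductSpace ℝ E]

lemma gramSchmidt_eq_sub_sum {n : ℕ} (f : Fin n → E) (i : Fin n) :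
    gramSchmidt ℝ f i = f i - ∑ j ∈ Finset.Iio i,
      (inner ℝ (gramSchmidt ℝ f j) (f i) / ‖gramSchmidt ℝ f j‖ ^ 2) • gramSchmidt ℝ f j := by
  rw [gramSchmidt_def]
  simp [Submodule.starProjection_singleton]

/-- The recursion uses only inner products, norms and linear combinations. This equivariance is the
source of every symmetry argument below. -/
lemma gramSchmidt_linearIsometryEquiv_comp {n : ℕ} (O : E ≃ₗᵢ[ℝ] E) (f : Fin n → E) (i : Fin n) :
    gramSchmidt ℝ (fun j => O (f j)) i = O (gramSchmidt ℝ f i) := by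
  induction i using WellFoundedLT.induction with
  | _ i ih =>
    rw [gramSchmidt_eq_sub_sum, gramSchmidt_eq_sub_sum f i, map_sub, map_sum]
    congr 1
    refine Finset.sum_congr rfl fun j hj => ?_
    rw [ih j (Finset.mem_Iio.1 hj), map_smul, O.inner_map_map, O.norm_map]

lemma gramSchmidtNormed_linearIsometryEquiv_comp {n : ℕ} (O : E ≃ₗᵢ[ℝ] E) (f : Fin n → E)
    (i : Fin n) :
    gramSchmidtNormed ℝ (fun j => O (f j)) i = O (gramSchmidtNormed ℝ f i) := by
  simp [gramSchmidtNormed, gramSchmidt_linearIsometryEquiv_comp]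

lemma gramSchmidt_append_castAdd {s m : ℕ} (k : Fin s → E) (r : Fin m → E) (i : Fin s) :
    gramSchmidt ℝ (Fin.append k r) (Fin.castAdd m i) = gramSchmidt ℝ k i := by
  induction i using WellFoundedLT.induction with
  | _ i ih =>
    rw [gramSchmidt_eq_sub_sum, gramSchmidt_eq_sub_sum k i, Fin.append_left]
    congr 1
    have h : Finset.Iio (Fin.castAdd m i) = (Finset.Iio i).map (Fin.castAddEmb m) := by
      ext j
      simp only [Finset.mem_Iio, Finset.mem_map, Fin.castAddEmb_apply]
      constructor
      · intro hj
        exact ⟨⟨j, lt_trans hj i.2⟩, hj, rfl⟩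
      · rintro ⟨j, hj, rfl⟩
        exact hj
    rw [h, Finset.sum_map]
    refine Finset.sum_congr rfl fun j hj => ?_
    rw [Fin.castAddEmb_apply, ih j (Finset.mem_Iio.1 hj)]

/-- Degenerate inputs produce zero vectors. Working with `≤ 1` instead of `= 1` makes the later norm
bounds hold for every draw, with no exceptional null set. -/
lemma norm_gramSchmidtNormed_le {n : ℕ} (f : Fin n → E) (i : Fin n) :
    ‖gramSchmidtNormed ℝ f i‖ ≤ 1 := by
  by_cases h : gramSchmidtNormed ℝ f i = 0
  · simp [h]
  · exact (gramSchmidtNormed_unit_length' h).le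

lemma inner_gramSchmidtNormed_of_ne {n : ℕ} (f : Fin n → E) {i j : Fin n} (h : i ≠ j) :
    inner ℝ (gramSchmidtNormed ℝ f i) (gramSchmidtNormed ℝ f j) = 0 := by
  simp [gramSchmidtNormed, inner_smul_left, inner_smul_right, gramSchmidt_orthogonal ℝ f h]

lemma norm_sum_smul_sq_le {ι : Type*} [Fintype ι] {w : ι → E}
    (horth : ∀ i j, i ≠ j → inner ℝ (w i) (w j) = 0) (hw : ∀ i, ‖w i‖ ≤ 1) (c : ι → ℝ) :
    ‖∑ i, c i • w i‖ ^ 2 ≤ ∑ i, c i ^ 2 := by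
  rw [← real_inner_self_eq_norm_sq, sum_inner]
  refine Finset.sum_le_sum fun i _ => ?_
  rw [inner_sum, Finset.sum_eq_single i]
  · rw [inner_smul_left, inner_smul_right, real_inner_self_eq_norm_sq]
    have : ‖w i‖ ^ 2 ≤ 1 := pow_le_one₀ (norm_nonneg _) (hw i)
    simp only [conj_trivial]
    nlinarith [sq_nonneg (c i)]
  · intro j _ hj
    simp [inner_smul_left, inner_smul_right, horth i j hj.symm]
  · simp

lemma sum_inner_sq_le {ι : Type*} [Fintype ι] {w : ι → E}
    (horth : ∀ i j, i ≠ j → inner ℝ (w i) (w j) = 0) (hw : ∀ i, ‖w i‖ ≤ 1) (g : E) :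
    ∑ i, inner ℝ g (w i) ^ 2 ≤ ‖g‖ ^ 2 := by
  have h1 := norm_sum_smul_sq_le horth hw fun i => inner ℝ g (w i)
  have h2 : inner ℝ g (∑ i, inner ℝ g (w i) • w i) = ∑ i, inner ℝ g (w i) ^ 2 := by
    simp [inner_sum, inner_smul_right, sq]
  have h3 := norm_sub_sq_real g (∑ i, inner ℝ g (w i) • w i)
  rw [h2] at h3
  nlinarith [sq_nonneg ‖g - ∑ i, inner ℝ g (w i) • w i‖]

end GramSchmidt

/-! ### Measurability of Gram–Schmidt. -/

section Measurability

lemma measurable_gramSchmidt {d n : ℕ} (i : Fin n) :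
    Measurable fun f : Fin n → Vec d => gramSchmidt ℝ f i := by
  induction i using WellFoundedLT.induction with
  | _ i ih =>
    have h : (fun f : Fin n → Vec d => gramSchmidt ℝ f i) = fun f => f i - ∑ j ∈ Finset.Iio i,
        (inner ℝ (gramSchmidt ℝ f j) (f i) / ‖gramSchmidt ℝ f j‖ ^ 2) • gramSchmidt ℝ f j :=
      funext fun f => gramSchmidt_eq_sub_sum f i
    rw [h]
    refine (measurable_pi_apply i).sub (Finset.measurable_sum _ fun j hj => ?_)
    have := ih j (Finset.mem_Iio.1 hj)
    exact ((this.inner (measurable_pi_apply i)).div (this.norm.pow_const 2)).smul this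

lemma measurable_gramSchmidtNormed {d n : ℕ} (i : Fin n) :
    Measurable fun f : Fin n → Vec d => gramSchmidtNormed ℝ f i := by
  have := measurable_gramSchmidt (d := d) i
  unfold gramSchmidtNormed
  exact (this.norm.inv).smul this

lemma measurable_append {d s m : ℕ} :
    Measurable fun x : (Fin s → Vec d) × (Fin m → Vec d) => Fin.append x.1 x.2 := by
  refine measurable_pi_lambda _ fun i => ?_
  refine Fin.addCases (fun i => ?_) (fun i => ?_) i <;> simp <;> fun_prop

end Measurability

/-! ### First-order inequalities for smooth convex functions. -/

section Smooth

variable {d : ℕ} {f : Vec d → ℝ}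

lemma hasDerivAt_comp_line (hf : Differentiable ℝ f) (x h : Vec d) (t : ℝ) :
    HasDerivAt (fun t : ℝ => f (x + t • h)) (inner ℝ (gradient f (x + t • h)) h) t := by
  have h1 : HasDerivAt (fun t : ℝ => x + t • h) h t := by
    simpa using ((hasDerivAt_id t).smul_const h).const_add x
  have h2 := (hf (x + t • h)).hasGradientAt.hasFDerivAt.comp_hasDerivAt t h1
  rwa [toDual_apply_apply] at h2

lemma inner_gradient_le_sub (hf : Differentiable ℝ f) (hc : ConvexOn ℝ Set.univ f) (x y : Vec d) :
    inner ℝ (gradient f x) (y - x) ≤ f y - f x := by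
  have h1 := hasDerivAt_comp_line hf x (y - x) 0
  have h2 : ConvexOn ℝ Set.univ fun t : ℝ => f (x + t • (y - x)) := by
    have := hc.comp_affineMap (AffineMap.lineMap x y : ℝ →ᵃ[ℝ] Vec d)
    simpa [Function.comp_def, AffineMap.lineMap_apply, add_comm] using this
  have h3 := h2.le_slope_of_hasDerivAt (Set.mem_univ 0) (Set.mem_univ 1) zero_lt_one h1
  simpa [slope_def_field] using h3

/-- Along the segment, the quadratic upper model minus `f` has nonnegative derivative because the
gradient is Lipschitz, so the gap at `1` is at least the gap at `0`. -/
lemma IsSmooth.le_add_inner_add {L : ℝ} (hf : IsSmooth f L) (x h : Vec d) :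
    f (x + h) ≤ f x + inner ℝ (gradient f x) h + L / 2 * ‖h‖ ^ 2 := by
  have hd : ∀ t : ℝ, HasDerivAt (fun t : ℝ => t * inner ℝ (gradient f x) h +
      L / 2 * ‖h‖ ^ 2 * t ^ 2 - f (x + t • h))
      (inner ℝ (gradient f x) h + L / 2 * ‖h‖ ^ 2 * (2 * t) -
        inner ℝ (gradient f (x + t • h)) h) t := by
    intro t
    refine (HasDerivAt.add ?_ ?_).sub (hasDerivAt_comp_line hf.1 x h t)
    · simpa using (hasDerivAt_id t).mul_const (inner ℝ (gradient f x) h)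
    · simpa using (hasDerivAt_pow 2 t).const_mul (L / 2 * ‖h‖ ^ 2)
  have hmono := monotoneOn_of_deriv_nonneg (convex_Icc (0 : ℝ) 1)
    (f := fun t : ℝ => t * inner ℝ (gradient f x) h +
      L / 2 * ‖h‖ ^ 2 * t ^ 2 - f (x + t • h))
    (fun t _ => (hd t).continuousAt.continuousWithinAt)
    (fun t _ => (hd t).differentiableAt.differentiableWithinAt) (fun t ht => by
      rw [interior_Icc] at ht
      rw [(hd t).deriv]
      have h1 : inner ℝ (gradient f (x + t • h) - gradient f x) h ≤ L * t * ‖h‖ ^ 2 := by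
        refine (real_inner_le_norm _ _).trans ?_
        have := hf.2 (x + t • h) x
        rw [add_sub_cancel_left, norm_smul, Real.norm_of_nonneg ht.1.le] at this
        nlinarith [norm_nonneg h]
      rw [inner_sub_left] at h1
      linarith)
  have := hmono (Set.left_mem_Icc.2 zero_le_one) (Set.right_mem_Icc.2 zero_le_one) zero_le_one
  simp only [zero_mul, zero_smul, one_smul, one_mul, add_zero, one_pow, mul_one, ne_eq,
    OfNat.ofNat_ne_zero, not_false_eq_true, zero_pow, mul_zero] at this
  linarith

lemma IsSmooth.continuous_gradient {L : ℝ} (hf : IsSmooth f L) : Continuous (gradient f) :=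
  (LipschitzWith.of_dist_le_mul (K := L.toNNReal) fun x y => by
    rw [dist_eq_norm, dist_eq_norm]
    exact (hf.2 x y).trans (by gcongr; exact Real.le_coe_toNNReal L)).continuous

/-- In positive dimension the punctured space is dense, so by continuity the minimizer is in fact
global. -/
lemma forall_le_of_isMinOn_compl_zero (hd : 0 < d) (hf : Continuous f) {x : Vec d}
    (hx : IsMinOn f {0}ᶜ x) (y : Vec d) : f x ≤ f y := by
  have : Nonempty (Fin d) := ⟨⟨0, hd⟩⟩
  have : Nontrivial (Vec d) := inferInstance
  have hc : IsClosed {y | f x ≤ f y} := isClosed_le continuous_const hf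
  have hdense : Dense ({0}ᶜ : Set (Vec d)) := dense_compl_singleton 0
  have : closure ({0}ᶜ : Set (Vec d)) ⊆ {y | f x ≤ f y} := hc.closure_subset_iff.2 fun z hz => hx hz
  exact this (hdense y)

end Smooth

/-! ### Moments and null sets of the standard Gaussian. -/

section StdGaussian

variable {d : ℕ}

lemma integral_abs_gaussianReal_zero_one : ∫ x, |x| ∂(gaussianReal 0 1) = √(2 / Real.pi) := by
  rw [integral_gaussianReal_eq_integral_smul one_ne_zero]
  have h1 : ∀ x : ℝ, gaussianPDFReal 0 1 x • |x| =
      (fun y => (√(2 * Real.pi))⁻¹ * (y ^ (1 : ℝ) * Real.exp (-(1 / 2) * y ^ (2 : ℝ)))) |x| := by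
    intro x
    simp [gaussianPDFReal]
    ring_nf
  rw [integral_congr_ae (ae_of_all _ h1), integral_comp_abs
    (f := fun y => (√(2 * Real.pi))⁻¹ * (y ^ (1 : ℝ) * Real.exp (-(1 / 2) * y ^ (2 : ℝ)))),
    integral_const_mul,
    integral_rpow_mul_exp_neg_mul_rpow two_pos (by norm_num) (by norm_num)]
  norm_num [Real.rpow_neg_one]
  rw [eq_div_iff (by positivity)]
  field_simp
  norm_num

lemma integral_inner_sq_stdGaussian {u : Vec d} (hu : ‖u‖ = 1) :
    ∫ h, inner ℝ h u ^ 2 ∂(stdGaussian (Vec d)) = 1 := by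
  have h1 := variance_dual_stdGaussian (innerSL ℝ u)
  rw [variance_of_integral_eq_zero (by fun_prop) (integral_strongDual_stdGaussian _)] at h1
  simpa [hu, real_inner_comm] using h1

lemma integral_abs_inner_mul_abs_inner_stdGaussian {u w : Vec d} (hu : ‖u‖ = 1) (hw : ‖w‖ = 1)
    (huw : inner ℝ u w = 0) :
    ∫ h, |inner ℝ h u| * |inner ℝ h w| ∂(stdGaussian (Vec d)) = 2 / Real.pi := by
  have hne : u ≠ w := by
    rintro rfl
    rw [real_inner_self_eq_norm_sq, hu] at huw
    norm_num at huw
  have ho : Orthonormal ℝ ((↑) : ({u, w} : Set (Vec d)) → Vec d) := by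
    rw [orthonormal_subtype_iff_ite]
    have huu : inner ℝ u u = (1 : ℝ) := by rw [real_inner_self_eq_norm_sq, hu, one_pow]
    have hww : inner ℝ w w = (1 : ℝ) := by rw [real_inner_self_eq_norm_sq, hw, one_pow]
    have hwu : inner ℝ w u = (0 : ℝ) := by rw [real_inner_comm, huw]
    rintro x (rfl | rfl) y (rfl | rfl) <;> simp [*, hne.symm]
  -- In an orthonormal basis containing `u` and `w`, the two inner products become distinct, hence
  -- independent, standard normal coordinates.
  obtain ⟨S, b, hS, hb⟩ := ho.exists_orthonormalBasis_extension
  have hu' : u ∈ S := hS (by simp)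
  have hw' : w ∈ S := hS (by simp)
  rw [stdGaussian_eq_map_pi_orthonormalBasis b, integral_map
    (Measurable.aemeasurable (by fun_prop)) (Measurable.aestronglyMeasurable (by fun_prop))]
  have hbu : b ⟨u, hu'⟩ = u := by rw [hb]
  have hbw : b ⟨w, hw'⟩ = w := by rw [hb]
  have h1 : ∀ (x : S → ℝ) (i : S), inner ℝ (∑ j, x j • b j) (b i) = x i := fun x i => by
    simp [sum_inner, inner_smul_left, b.inner_eq_ite]
  have h2 : ∀ (x : S → ℝ), |inner ℝ (∑ j, x j • b j) u| * |inner ℝ (∑ j, x j • b j) w| =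
      |x ⟨u, hu'⟩| * |x ⟨w, hw'⟩| := fun x => by
    rw [← h1 x ⟨u, hu'⟩, ← h1 x ⟨w, hw'⟩, hbu, hbw]
  simp_rw [h2]
  have hi := iIndepFun_pi (μ := fun _ : S => gaussianReal 0 1) (X := fun _ x => |x|)
    (fun _ => by fun_prop)
  have hi' := hi.indepFun (i := ⟨u, hu'⟩) (j := ⟨w, hw'⟩) (by simpa using hne)
  rw [hi'.integral_fun_mul_eq_mul_integral
    (Measurable.aestronglyMeasurable (by fun_prop)) (Measurable.aestronglyMeasurable (by fun_prop))]
  have h3 : ∀ i : S, ∫ x : S → ℝ, |x i| ∂(Measure.pi fun _ => gaussianReal 0 1) =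
      √(2 / Real.pi) := fun i => by
    rw [← integral_abs_gaussianReal_zero_one]
    exact integral_comp_eval (μ := fun _ : S => gaussianReal 0 1) (by fun_prop)
  rw [h3, h3, Real.mul_self_sqrt (by positivity)]

lemma stdGaussian_inner_eq_zero {u : Vec d} (hu : u ≠ 0) :
    stdGaussian (Vec d) {h | inner ℝ h u = 0} = 0 := by
  have h1 := IsGaussian.map_eq_gaussianReal (μ := stdGaussian (Vec d)) (innerSL ℝ u)
  rw [variance_dual_stdGaussian] at h1
  have hv : (‖innerSL ℝ u‖ ^ 2).toNNReal ≠ 0 := by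
    simpa using hu
  have := nullSingletonClass_gaussianReal (μ := (stdGaussian (Vec d))[innerSL ℝ u]) hv
  have h2 : (stdGaussian (Vec d)).map (innerSL ℝ u) {0} = 0 := by
    rw [h1]
    exact measure_singleton 0
  rw [Measure.map_apply (by fun_prop) (measurableSet_singleton 0)] at h2
  convert h2 using 2
  ext h
  simp [real_inner_comm]

lemma stdGaussian_submodule_eq_zero {K : Submodule ℝ (Vec d)} (hK : K ≠ ⊤) :
    stdGaussian (Vec d) K = 0 := by
  have : Kᗮ ≠ ⊥ := by rwa [ne_eq, Submodule.orthogonal_eq_bot_iff]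
  obtain ⟨u, hu, hu0⟩ := Submodule.exists_mem_ne_zero_of_ne_bot this
  exact measure_mono_null (fun h hh => Submodule.inner_right_of_mem_orthogonal hh hu)
    (stdGaussian_inner_eq_zero hu0)

lemma integrable_norm_sq_stdGaussian :
    Integrable (fun h => ‖h‖ ^ 2) (stdGaussian (Vec d)) :=
  IsGaussian.memLp_two_id.integrable_norm_pow (by norm_num)

lemma integral_norm_sq_stdGaussian : ∫ h, ‖h‖ ^ 2 ∂(stdGaussian (Vec d)) = d := by
  have h1 : ∀ h : Vec d, ‖h‖ ^ 2 = ∑ i, inner ℝ h (EuclideanSpace.basisFun (Fin d) ℝ i) ^ 2 :=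
    fun h => ((EuclideanSpace.basisFun (Fin d) ℝ).sum_sq_inner_left h).symm
  simp_rw [h1]
  rw [integral_finsetSum]
  · simp_rw [integral_inner_sq_stdGaussian (OrthonormalBasis.norm_eq_one _ _)]
    simp
  · intro i _
    refine integrable_norm_sq_stdGaussian.mono' (by fun_prop) (ae_of_all _ fun h => ?_)
    rw [Real.norm_of_nonneg (sq_nonneg _), sq_le_sq, abs_norm]
    simpa using abs_real_inner_le_norm h (EuclideanSpace.basisFun (Fin d) ℝ i)

end StdGaussian

/-! ### Algebra of the directions, and almost sure nondegeneracy. -/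

section Estimators

variable {d s m : ℕ}

/-- The priors come first in the orthonormalization, so the draws do not affect them. Thus the prior
quality, and with it the step-size cap, does not depend on `r`. -/
lemma priorDir_eq (k : Fin s → Vec d) (r : Fin m → Vec d) (i : Fin s) :
    priorDir k r i = gramSchmidtNormed ℝ k i := by
  simp [priorDir, gramSchmidtNormed, gramSchmidt_append_castAdd]

lemma norm_priorDir_le (k : Fin s → Vec d) (r : Fin m → Vec d) (i : Fin s) :
    ‖priorDir k r i‖ ≤ 1 := norm_gramSchmidtNormed_le _ _

lemma norm_randDir_le (k : Fin s → Vec d) (r : Fin m → Vec d) (j : Fin m) :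
    ‖randDir k r j‖ ≤ 1 := norm_gramSchmidtNormed_le _ _

lemma inner_priorDir_of_ne (k : Fin s → Vec d) (r : Fin m → Vec d) (i j : Fin s) (h : i ≠ j) :
    inner ℝ (priorDir k r i) (priorDir k r j) = 0 :=
  inner_gramSchmidtNormed_of_ne _ (by simpa using h)

lemma inner_randDir_of_ne (k : Fin s → Vec d) (r : Fin m → Vec d) (i j : Fin m) (h : i ≠ j) :
    inner ℝ (randDir k r i) (randDir k r j) = 0 :=
  inner_gramSchmidtNormed_of_ne _ (by simpa using h)

lemma inner_priorDir_randDir (k : Fin s → Vec d) (r : Fin m → Vec d) (i : Fin s) (j : Fin m) :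
    inner ℝ (priorDir k r i) (randDir k r j) = 0 :=
  inner_gramSchmidtNormed_of_ne _ (ne_of_lt (by simp [Fin.lt_def]; omega))

lemma randDir_linearIsometryEquiv_comp {k : Fin s → Vec d} {O : Vec d ≃ₗᵢ[ℝ] Vec d}
    (hO : ∀ i, O (k i) = k i) (r : Fin m → Vec d) (j : Fin m) :
    randDir k (fun j => O (r j)) j = O (randDir k r j) := by
  rw [randDir, randDir, ← gramSchmidtNormed_linearIsometryEquiv_comp]
  congr 1
  ext1 i
  refine Fin.addCases (fun i => ?_) (fun i => ?_) i <;> simp [hO]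

lemma sum_inner_priorDir_sq_le (g : Vec d) (k : Fin s → Vec d) (r : Fin m → Vec d) :
    ∑ i, inner ℝ g (priorDir k r i) ^ 2 ≤ ‖g‖ ^ 2 :=
  sum_inner_sq_le (inner_priorDir_of_ne k r) (norm_priorDir_le k r) g

lemma inner_signDir (x g : Vec d) (k : Fin s → Vec d) (r : Fin m → Vec d) :
    inner ℝ x (signDir g k r) =
      1 / √m * ∑ j, Real.sign (inner ℝ g (randDir k r j)) * inner ℝ x (randDir k r j) := by
  simp [signDir, inner_smul_right, inner_sum]

lemma inner_signDir_self (g : Vec d) (k : Fin s → Vec d) (r : Fin m → Vec d) :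
    inner ℝ g (signDir g k r) = 1 / √m * ∑ j, |inner ℝ g (randDir k r j)| := by
  rw [inner_signDir]
  congr 1
  refine Finset.sum_congr rfl fun j _ => ?_
  rcases lt_trichotomy (inner ℝ g (randDir k r j)) 0 with h | h | h
  · rw [Real.sign_of_neg h, abs_of_neg h]; ring
  · simp [h]
  · rw [Real.sign_of_pos h, abs_of_pos h]; ring

lemma inner_priorDir_signDir (g : Vec d) (k : Fin s → Vec d) (r : Fin m → Vec d) (i : Fin s) :
    inner ℝ (priorDir k r i) (signDir g k r) = 0 := by
  simp [inner_signDir, inner_priorDir_randDir]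

lemma norm_signDir_le (g : Vec d) (k : Fin s → Vec d) (r : Fin m → Vec d) :
    ‖signDir g k r‖ ≤ 1 := by
  have h1 := norm_sum_smul_sq_le (inner_randDir_of_ne k r) (norm_randDir_le k r)
    fun j => Real.sign (inner ℝ g (randDir k r j))
  have h2 : ∑ j, Real.sign (inner ℝ g (randDir k r j)) ^ 2 ≤ (m : ℝ) := by
    refine (Finset.sum_le_card_nsmul _ _ 1 fun j _ => ?_).trans (by simp)
    rcases Real.sign_apply_eq (inner ℝ g (randDir k r j)) with h | h | h <;> rw [h] <;> norm_num
  have h3 : ‖signDir g k r‖ ^ 2 ≤ 1 := by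
    rw [signDir, norm_smul, mul_pow, Real.norm_of_nonneg (by positivity), div_pow, one_pow,
      Real.sq_sqrt (Nat.cast_nonneg _), one_div, inv_mul_eq_div]
    exact div_le_one_of_le₀ (h1.trans h2) (Nat.cast_nonneg _)
  exact (sq_le_one_iff₀ (norm_nonneg _)).1 h3

lemma signDir_congr {g g' : Vec d} (k : Fin s → Vec d) (r : Fin m → Vec d)
    (h : ∀ j, inner ℝ g (randDir k r j) = inner ℝ g' (randDir k r j)) :
    signDir g k r = signDir g' k r := by
  simp [signDir, h]

lemma signDir_linearIsometryEquiv_comp {k : Fin s → Vec d} {O : Vec d ≃ₗᵢ[ℝ] Vec d}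
    (hO : ∀ i, O (k i) = k i) (g : Vec d) (r : Fin m → Vec d) :
    signDir (O g) k (fun j => O (r j)) = O (signDir g k r) := by
  simp [signDir, randDir_linearIsometryEquiv_comp hO, map_sum]

lemma measurable_sign : Measurable Real.sign := by
  unfold Real.sign
  exact Measurable.ite measurableSet_Iio measurable_const
    (Measurable.ite measurableSet_Ioi measurable_const measurable_const)

section Measurability

variable {X : Type*} {mX : MeasurableSpace X} {g : X → Vec d} {k : X → Fin s → Vec d}
  {r : X → Fin m → Vec d}

lemma measurable_randDir (hk : Measurable k) (hr : Measurable r) (j : Fin m) :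
    Measurable fun x => randDir (k x) (r x) j :=
  (measurable_gramSchmidtNormed _).comp (measurable_append.comp (hk.prodMk hr))

lemma measurable_priorDir (hk : Measurable k) (hr : Measurable r) (i : Fin s) :
    Measurable fun x => priorDir (k x) (r x) i :=
  (measurable_gramSchmidtNormed _).comp (measurable_append.comp (hk.prodMk hr))

lemma measurable_signDir (hg : Measurable g) (hk : Measurable k) (hr : Measurable r) :
    Measurable fun x => signDir (g x) (k x) (r x) := by
  unfold signDir
  have h1 := measurable_randDir hk hr
  have h2 : ∀ j, Measurable fun x => Real.sign (inner ℝ (g x) (randDir (k x) (r x) j)) :=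
    fun j => measurable_sign.comp (hg.inner (h1 j))
  exact Measurable.const_smul (Finset.measurable_sum _ fun j _ => (h2 j).smul (h1 j))
    (1 / √(m : ℝ))

lemma measurable_priorPart (hg : Measurable g) (hk : Measurable k) (hr : Measurable r) :
    Measurable fun x => priorPart (g x) (k x) (r x) := by
  unfold priorPart
  have h1 := measurable_priorDir hk hr
  exact Finset.measurable_sum _ fun i _ => (hg.inner (𝕜 := ℝ) (h1 i)).smul (h1 i)

lemma measurable_gradEst₁ (hg : Measurable g) (hk : Measurable k) (hr : Measurable r) :
    Measurable fun x => gradEst₁ (g x) (k x) (r x) := by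
  unfold gradEst₁
  have h := measurable_signDir hg hk hr
  exact ((hg.inner (𝕜 := ℝ) h).smul h).add (measurable_priorPart hg hk hr)

lemma measurable_gradEst₂ (q : ℕ) (hg : Measurable g) (hk : Measurable k) (hr : Measurable r) :
    Measurable fun x => gradEst₂ q (g x) (k x) (r x) := by
  unfold gradEst₂
  have h := measurable_signDir hg hk hr
  exact (((hg.inner (𝕜 := ℝ) h).const_mul _).smul h).add (measurable_priorPart hg hk hr)

end Measurability

lemma mem_span_of_gramSchmidt_eq_zero {n : ℕ} {f : Fin n → Vec d} {i : Fin n}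
    (h : gramSchmidt ℝ f i = 0) : f i ∈ Submodule.span ℝ (f '' Set.Iio i) := by
  have h1 := gramSchmidt_eq_sub_sum f i
  rw [h, eq_comm, sub_eq_zero] at h1
  rw [h1]
  refine Submodule.sum_mem _ fun j hj => Submodule.smul_mem _ _ ?_
  refine Submodule.span_mono (Set.image_mono fun l hl => ?_) (gramSchmidt_mem_span ℝ f le_rfl)
  exact lt_of_le_of_lt hl (Finset.mem_Iio.1 hj)

/-- A vanishing Gram–Schmidt vector forces `r j` into the span of the other vectors. With those
frozen, they number at most `d - 1`, so the span is a proper subspace and Gaussian-null. -/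
lemma ae_gramSchmidt_append_ne_zero (k : Fin s → Vec d) (hsm : s + m ≤ d) (j : Fin m) :
    ∀ᵐ r ∂(Measure.pi fun _ : Fin m => stdGaussian (Vec d)),
      gramSchmidt ℝ (Fin.append k r) (Fin.natAdd s j) ≠ 0 := by
  obtain ⟨m, rfl⟩ : ∃ n, m = n + 1 := ⟨m - 1, by have := j.2; omega⟩
  have hmeas : MeasurableSet
      {r : Fin (m + 1) → Vec d | gramSchmidt ℝ (Fin.append k r) (Fin.natAdd s j) = 0} :=
    ((measurable_gramSchmidt (Fin.natAdd s j)).comp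
      (measurable_append.comp (measurable_const.prodMk measurable_id))) (measurableSet_singleton 0)
  have hmp := measurePreserving_piFinSuccAbove (fun _ : Fin (m + 1) => stdGaussian (Vec d)) j
  simp only [ae_iff, not_not]
  -- Fubini, isolating coordinate `j` as the inner variable.
  rw [← hmp.symm.measure_preimage hmeas.nullMeasurableSet,
    Measure.prod_apply_symm ((MeasurableEquiv.measurable _) hmeas)]
  refine (lintegral_congr fun y => ?_).trans lintegral_zero
  have hW : Submodule.span ℝ (Set.range (Fin.append k y)) ≠ ⊤ := by
    intro h
    have h1 := finrank_range_le_card (R := ℝ) (Fin.append k y)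
    rw [Set.finrank, h, finrank_top, finrank_euclideanSpace_fin, Fintype.card_fin] at h1
    omega
  refine measure_mono_null (fun x hx => ?_) (stdGaussian_submodule_eq_zero hW)
  have hx' := mem_span_of_gramSchmidt_eq_zero (f := Fin.append k (j.insertNth x y)) hx
  rw [Fin.append_right, Fin.insertNth_apply_same] at hx'
  refine Submodule.span_mono ?_ hx'
  rintro _ ⟨i, hi, rfl⟩
  induction i using Fin.addCases with
  | left i => exact ⟨Fin.castAdd m i, by simp⟩
  | right i =>
    have hij : i ≠ j := by
      rintro rfl
      exact lt_irrefl _ (Set.mem_Iio.1 hi)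
    obtain ⟨l, rfl⟩ := Fin.exists_succAbove_eq hij
    exact ⟨Fin.natAdd s l, by simp⟩

lemma ae_orthonormal_gramSchmidtNormed {k : Fin s → Vec d} (hk : LinearIndependent ℝ k)
    (hsm : s + m ≤ d) :
    ∀ᵐ r ∂(Measure.pi fun _ : Fin m => stdGaussian (Vec d)),
      Orthonormal ℝ (gramSchmidtNormed ℝ (Fin.append k r)) := by
  filter_upwards [ae_all_iff.2 (ae_gramSchmidt_append_ne_zero k hsm)] with r hr
  refine ⟨fun i => ?_, fun i j => inner_gramSchmidtNormed_of_ne _⟩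
  refine gramSchmidtNormed_unit_length' ?_
  have h : gramSchmidt ℝ (Fin.append k r) i ≠ 0 := by
    induction i using Fin.addCases with
    | left i =>
      rw [gramSchmidt_append_castAdd]
      exact gramSchmidt_ne_zero i hk
    | right i => exact hr i
  simpa [gramSchmidtNormed] using h

end Estimators

/-! ### Second moments of the sign direction. -/

section Gaussian

variable {d s m : ℕ}

/-- The law of `m` independent standard Gaussian vectors. -/
abbrev gaussianVectors (d m : ℕ) : Measure (Fin m → Vec d) :=
  Measure.pi fun _ => stdGaussian (Vec d)

/-- The component of `g` orthogonal to the priors. -/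
def priorResidual (k : Fin s → Vec d) (g : Vec d) : Vec d :=
  g - ∑ i, inner ℝ g (gramSchmidtNormed ℝ k i) • gramSchmidtNormed ℝ k i

section Residual

variable {k : Fin s → Vec d}

lemma inner_priorResidual_gramSchmidtNormed (hk : LinearIndependent ℝ k) (g : Vec d) (i : Fin s) :
    inner ℝ (priorResidual k g) (gramSchmidtNormed ℝ k i) = 0 := by
  have ho := gramSchmidtNormed_orthonormal hk
  rw [priorResidual, inner_sub_left, sum_inner, Finset.sum_eq_single i]
  · rw [inner_smul_left, real_inner_self_eq_norm_sq, ho.1 i]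
    simp
  · intro j _ hj
    rw [inner_smul_left, ho.2 hj, mul_zero]
  · simp

lemma inner_priorResidual_left (hk : LinearIndependent ℝ k) (g : Vec d) (i : Fin s) :
    inner ℝ (k i) (priorResidual k g) = 0 := by
  have h : k i ∈ (Submodule.span ℝ {priorResidual k g})ᗮ := by
    have h1 : Submodule.span ℝ (Set.range k) ≤ (Submodule.span ℝ {priorResidual k g})ᗮ := by
      rw [← span_gramSchmidt, ← span_gramSchmidtNormed_range, Submodule.span_le]
      rintro _ ⟨j, rfl⟩
      exact Submodule.mem_orthogonal_singleton_iff_inner_right.2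
        (inner_priorResidual_gramSchmidtNormed hk g j)
    exact h1 (Submodule.subset_span ⟨i, rfl⟩)
  exact Submodule.mem_orthogonal_singleton_iff_inner_left.1 h

lemma inner_priorResidual_priorResidual (hk : LinearIndependent ℝ k) (g w : Vec d) :
    inner ℝ (priorResidual k g) (priorResidual k w) = inner ℝ g w -
      ∑ i, inner ℝ g (gramSchmidtNormed ℝ k i) * inner ℝ w (gramSchmidtNormed ℝ k i) := by
  conv_lhs => rw [priorResidual.eq_def k w, inner_sub_right, inner_sum]
  simp_rw [inner_smul_right, inner_priorResidual_gramSchmidtNormed hk]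
  rw [priorResidual, inner_sub_left, sum_inner]
  simp [inner_smul_right, real_inner_comm w]

lemma inner_priorResidual_randDir (g : Vec d) (r : Fin m → Vec d) (j : Fin m) :
    inner ℝ (priorResidual k g) (randDir k r j) = inner ℝ g (randDir k r j) := by
  have h : ∀ i, inner ℝ (gramSchmidtNormed ℝ k i) (randDir k r j) = (0 : ℝ) := fun i => by
    rw [← priorDir_eq k r, inner_priorDir_randDir]
  simp [priorResidual, inner_sub_left, sum_inner, inner_smul_left, h]

/-- The sign direction is built from vectors orthogonal to the priors, so it sees only residuals.
This reduces the moment computation to vectors orthogonal to every `k i`. -/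
lemma inner_priorResidual_signDir (x g : Vec d) (r : Fin m → Vec d) :
    inner ℝ (priorResidual k x) (signDir (priorResidual k g) k r) = inner ℝ x (signDir g k r) := by
  rw [signDir_congr k r (inner_priorResidual_randDir g r), inner_signDir, inner_signDir]
  simp_rw [inner_priorResidual_randDir]

end Residual

lemma measurePreserving_linearIsometryEquiv_comp (O : Vec d ≃ₗᵢ[ℝ] Vec d) :
    MeasurePreserving (fun (r : Fin m → Vec d) j => O (r j)) (gaussianVectors d m)
      (gaussianVectors d m) :=
  measurePreserving_pi _ _ fun _ => ⟨O.continuous.measurable, stdGaussian_map O⟩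

section Integral

variable {k : Fin s → Vec d}

lemma measurable_inner_signDir_right (x g : Vec d) (k : Fin s → Vec d) :
    Measurable fun r : Fin m → Vec d => (inner ℝ x (signDir g k r) : ℝ) :=
  measurable_const.inner (measurable_signDir measurable_const measurable_const measurable_id)

lemma abs_inner_signDir_le (x g : Vec d) (k : Fin s → Vec d) (r : Fin m → Vec d) :
    |inner ℝ x (signDir g k r)| ≤ ‖x‖ :=
  (abs_real_inner_le_norm _ _).trans
    (mul_le_of_le_one_right (norm_nonneg _) (norm_signDir_le g k r))

lemma integrable_inner_signDir_mul (x w g : Vec d) (k : Fin s → Vec d) :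
    Integrable (fun r : Fin m → Vec d => inner ℝ x (signDir g k r) * inner ℝ w (signDir g k r))
      (gaussianVectors d m) := by
  refine Integrable.of_bound (C := ‖x‖ * ‖w‖) ((measurable_inner_signDir_right x g k).mul
    (measurable_inner_signDir_right w g k)).aestronglyMeasurable (ae_of_all _ fun r => ?_)
  rw [norm_mul]
  exact mul_le_mul (abs_inner_signDir_le x g k r) (abs_inner_signDir_le w g k r) (norm_nonneg _)
    (norm_nonneg _)

lemma integral_inner_signDir_mul_linearIsometryEquiv {O : Vec d ≃ₗᵢ[ℝ] Vec d}
    (hO : ∀ i, O (k i) = k i) (x w g : Vec d) :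
    ∫ r, inner ℝ (O x) (signDir (O g) k r) * inner ℝ (O w) (signDir (O g) k r)
        ∂(gaussianVectors d m) =
      ∫ r, inner ℝ x (signDir g k r) * inner ℝ w (signDir g k r) ∂(gaussianVectors d m) := by
  conv_lhs => rw [← (measurePreserving_linearIsometryEquiv_comp O).map_eq]
  have hm : Measurable fun r : Fin m → Vec d => (inner ℝ (O x) (signDir (O g) k r) : ℝ) *
      inner ℝ (O w) (signDir (O g) k r) :=
    (measurable_inner_signDir_right _ _ _).mul (measurable_inner_signDir_right _ _ _)
  rw [integral_map (measurePreserving_linearIsometryEquiv_comp O).measurable.aemeasurable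
    hm.aestronglyMeasurable]
  simp_rw [signDir_linearIsometryEquiv_comp hO, O.inner_map_map]

lemma reflection_apply_of_inner_eq_zero {x z : Vec d} (h : inner ℝ x z = 0) :
    (Submodule.span ℝ {z})ᗮ.reflection x = x :=
  Submodule.reflection_mem_subspace_eq_self
    (Submodule.mem_orthogonal_singleton_iff_inner_left.2 h)

/-- The reflection sending `z` to `-z` fixes `g` and the priors, so the integral equals its own
negative. -/
lemma integral_inner_signDir_mul_eq_zero {g z : Vec d} (hz : ∀ i, inner ℝ (k i) z = 0)
    (hgz : inner ℝ g z = 0) :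
    ∫ r, inner ℝ g (signDir g k r) * inner ℝ z (signDir g k r) ∂(gaussianVectors d m) = 0 := by
  have h := integral_inner_signDir_mul_linearIsometryEquiv (m := m)
    (O := (Submodule.span ℝ {z})ᗮ.reflection)
    (fun i => reflection_apply_of_inner_eq_zero (hz i)) g z g
  rw [reflection_apply_of_inner_eq_zero hgz,
    Submodule.reflection_orthogonalComplement_singleton_eq_neg] at h
  simp only [inner_neg_left, mul_neg, integral_neg] at h
  linarith

lemma inner_smul_signDir_smul {c : ℝ} (hc : 0 ≤ c) (g : Vec d) (r : Fin m → Vec d) :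
    inner ℝ (c • g) (signDir (c • g) k r) = c * inner ℝ g (signDir g k r) := by
  simp_rw [inner_signDir_self, inner_smul_left, abs_mul, conj_trivial, abs_of_nonneg hc,
    ← Finset.mul_sum]
  ring

/-- The reflection along `h - ‖h‖ • e` exchanges `h` with `‖h‖ • e` and fixes the priors; positive
homogeneity then extracts the norm. -/
lemma integral_inner_signDir_sq_eq_mul {e h : Vec d} (he : ‖e‖ = 1)
    (hke : ∀ i, inner ℝ (k i) e = 0) (hkh : ∀ i, inner ℝ (k i) h = 0) :
    ∫ r, inner ℝ h (signDir h k r) ^ 2 ∂(gaussianVectors d m) =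
      ‖h‖ ^ 2 * ∫ r, inner ℝ e (signDir e k r) ^ 2 ∂(gaussianVectors d m) := by
  have hn : ‖h‖ = ‖‖h‖ • e‖ := by rw [norm_smul, he, norm_norm, mul_one]
  have h1 := integral_inner_signDir_mul_linearIsometryEquiv (m := m)
    (O := (Submodule.span ℝ {h - ‖h‖ • e})ᗮ.reflection)
    (fun i => reflection_apply_of_inner_eq_zero (x := k i)
      (by rw [inner_sub_right, inner_smul_right, hke, hkh, mul_zero, sub_zero])) h h h
  rw [Submodule.reflection_sub hn] at h1
  simp_rw [inner_smul_signDir_smul (norm_nonneg h), ← sq, mul_pow] at h1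
  rw [← h1, integral_const_mul]

/-- Here `r` is fixed and `g` is random. The square of `m^{-1/2} ∑ |gᵀuⱼ|` has `m` diagonal terms of
mean `1` and `m (m - 1)` cross terms of mean `2/π`. -/
lemma integral_inner_signDir_sq_stdGaussian {r : Fin m → Vec d} (hm : 0 < m)
    (ho : Orthonormal ℝ (gramSchmidtNormed ℝ (Fin.append k r))) :
    ∫ g, inner ℝ g (signDir g k r) ^ 2 ∂(stdGaussian (Vec d)) =
      1 + ((m : ℝ) - 1) * (2 / Real.pi) := by
  have hm' : (0 : ℝ) < m := by exact_mod_cast hm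
  have hu : ∀ j, ‖randDir k r j‖ = 1 := fun j => ho.1 _
  have h1 : ∀ g : Vec d, inner ℝ g (signDir g k r) ^ 2 = 1 / m *
      ∑ i, ∑ j, |inner ℝ g (randDir k r i)| * |inner ℝ g (randDir k r j)| := fun g => by
    rw [inner_signDir_self, mul_pow, div_pow, Real.sq_sqrt hm'.le, one_pow, sq (∑ j, _),
      Finset.sum_mul_sum]
  have h2 : ∀ i j, Integrable (fun g : Vec d =>
      |inner ℝ g (randDir k r i)| * |inner ℝ g (randDir k r j)|) (stdGaussian (Vec d)) := by
    intro i j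
    refine integrable_norm_sq_stdGaussian.mono' (by fun_prop) (ae_of_all _ fun g => ?_)
    rw [norm_mul, Real.norm_eq_abs, Real.norm_eq_abs, abs_abs, abs_abs, sq]
    exact mul_le_mul ((abs_real_inner_le_norm _ _).trans (mul_le_of_le_one_right (norm_nonneg _)
      (norm_randDir_le k r i))) ((abs_real_inner_le_norm _ _).trans (mul_le_of_le_one_right
      (norm_nonneg _) (norm_randDir_le k r j))) (abs_nonneg _) (norm_nonneg _)
  have h3 : ∀ i j, ∫ g : Vec d, |inner ℝ g (randDir k r i)| * |inner ℝ g (randDir k r j)|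
      ∂(stdGaussian (Vec d)) = 2 / Real.pi + if i = j then 1 - 2 / Real.pi else 0 := by
    intro i j
    split_ifs with hij
    · subst hij
      simp_rw [← sq, sq_abs]
      rw [integral_inner_sq_stdGaussian (hu _)]
      ring
    · rw [integral_abs_inner_mul_abs_inner_stdGaussian (hu _) (hu _)
        (inner_randDir_of_ne k r i j hij), add_zero]
  simp_rw [h1]
  rw [integral_const_mul, integral_finsetSum _ fun i _ => integrable_finsetSum _ fun j _ => h2 i j]
  simp_rw [integral_finsetSum _ fun j _ => h2 _ j, h3]
  simp [Finset.sum_add_distrib]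
  field_simp
  ring

lemma integrable_inner_signDir_sq_prod (k : Fin s → Vec d) :
    Integrable (fun x : Vec d × (Fin m → Vec d) => (inner ℝ x.1 (signDir x.1 k x.2) : ℝ) ^ 2)
      ((stdGaussian (Vec d)).prod (gaussianVectors d m)) := by
  have hmeas : Measurable fun x : Vec d × (Fin m → Vec d) =>
      (inner ℝ x.1 (signDir x.1 k x.2) : ℝ) :=
    measurable_fst.inner (measurable_signDir measurable_fst measurable_const measurable_snd)
  refine (integrable_norm_sq_stdGaussian.comp_fst (gaussianVectors d m)).mono'
    (hmeas.pow_const 2).aestronglyMeasurable (ae_of_all _ fun x => ?_)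
  rw [Real.norm_of_nonneg (sq_nonneg _), ← sq_abs]
  gcongr
  exact abs_inner_signDir_le _ _ _ _

lemma norm_priorResidual_sq (hk : LinearIndependent ℝ k) (g : Vec d) :
    ‖priorResidual k g‖ ^ 2 = ‖g‖ ^ 2 - ∑ i, inner ℝ g (gramSchmidtNormed ℝ k i) ^ 2 := by
  rw [← real_inner_self_eq_norm_sq, inner_priorResidual_priorResidual hk,
    real_inner_self_eq_norm_sq]
  simp_rw [sq]

lemma integral_norm_priorResidual_sq (hk : LinearIndependent ℝ k) :
    ∫ g, ‖priorResidual k g‖ ^ 2 ∂(stdGaussian (Vec d)) = (d : ℝ) - s := by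
  have ho := gramSchmidtNormed_orthonormal hk
  have hi : ∀ i, Integrable (fun g : Vec d => (inner ℝ g (gramSchmidtNormed ℝ k i) : ℝ) ^ 2)
      (stdGaussian (Vec d)) := fun i => by
    refine integrable_norm_sq_stdGaussian.mono' (by fun_prop) (ae_of_all _ fun g => ?_)
    rw [Real.norm_of_nonneg (sq_nonneg _), ← sq_abs]
    gcongr
    exact (abs_real_inner_le_norm _ _).trans (by rw [ho.1, mul_one])
  simp_rw [norm_priorResidual_sq hk]
  rw [integral_sub integrable_norm_sq_stdGaussian (integrable_finsetSum _ fun i _ => hi i),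
    integral_norm_sq_stdGaussian, integral_finsetSum _ fun i _ => hi i]
  simp_rw [integral_inner_sq_stdGaussian (ho.1 _)]
  simp

lemma exists_norm_eq_one_inner_eq_zero (k : Fin s → Vec d) (hs : s < d) :
    ∃ e : Vec d, ‖e‖ = 1 ∧ ∀ i, inner ℝ (k i) e = 0 := by
  have hW : Submodule.span ℝ (Set.range k) ≠ ⊤ := by
    intro h
    have h1 := finrank_range_le_card (R := ℝ) k
    rw [Set.finrank, h, finrank_top, finrank_euclideanSpace_fin, Fintype.card_fin] at h1
    omega
  rw [ne_eq, ← Submodule.orthogonal_eq_bot_iff] at hW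
  obtain ⟨u, hu, hu0⟩ := Submodule.exists_mem_ne_zero_of_ne_bot hW
  refine ⟨‖u‖⁻¹ • u, norm_smul_inv_norm hu0, fun i => ?_⟩
  have h := Submodule.inner_right_of_mem_orthogonal
    (Submodule.subset_span (Set.mem_range_self i)) hu
  simp [inner_smul_right, h]

/-- By symmetry the integral is an unknown constant times `‖priorResidual k g‖²`. Averaging over
Gaussian `g` and swapping integrals determines it: the residual has mean square `d - s`, and the
swapped integral is explicit. -/
lemma integral_inner_signDir_sq (hk : LinearIndependent ℝ k) (hm : 0 < m) (hsm : s + m ≤ d)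
    (g : Vec d) :
    ∫ r, inner ℝ g (signDir g k r) ^ 2 ∂(gaussianVectors d m) =
      (1 + ((m : ℝ) - 1) * (2 / Real.pi)) / (d - s) * ‖priorResidual k g‖ ^ 2 := by
  obtain ⟨e, he, hke⟩ := exists_norm_eq_one_inner_eq_zero k (by omega)
  have h1 : ∀ g, ∫ r, inner ℝ g (signDir g k r) ^ 2 ∂(gaussianVectors d m) =
      ‖priorResidual k g‖ ^ 2 * ∫ r, inner ℝ e (signDir e k r) ^ 2 ∂(gaussianVectors d m) := by
    intro g
    rw [← integral_inner_signDir_sq_eq_mul he hke (inner_priorResidual_left hk g)]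
    simp_rw [inner_priorResidual_signDir]
  have h2 : ∫ g, ∫ r, inner ℝ g (signDir g k r) ^ 2 ∂(gaussianVectors d m)
      ∂(stdGaussian (Vec d)) = 1 + ((m : ℝ) - 1) * (2 / Real.pi) := by
    rw [integral_integral_swap (integrable_inner_signDir_sq_prod k)]
    rw [integral_congr_ae ((ae_orthonormal_gramSchmidtNormed hk hsm).mono fun r hr =>
      integral_inner_signDir_sq_stdGaussian hm hr)]
    simp
  rw [integral_congr_ae (ae_of_all _ h1)] at h2
  rw [integral_mul_const, integral_norm_priorResidual_sq hk] at h2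
  have hds : (d : ℝ) - s ≠ 0 := by
    have : (s : ℝ) + m ≤ d := by exact_mod_cast hsm
    have : (0 : ℝ) < m := by exact_mod_cast hm
    linarith
  rw [h1, ← h2]
  field_simp

lemma integral_inner_signDir_mul (hk : LinearIndependent ℝ k) (hm : 0 < m) (hsm : s + m ≤ d)
    (g w : Vec d) :
    ∫ r, inner ℝ g (signDir g k r) * inner ℝ w (signDir g k r) ∂(gaussianVectors d m) =
      (1 + ((m : ℝ) - 1) * (2 / Real.pi)) / (d - s) *
        inner ℝ (priorResidual k g) (priorResidual k w) := by
  set g' := priorResidual k g with hg'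
  set w' := priorResidual k w with hw'
  -- The projection coefficient of `w'` on `g'`: the remainder `w' - t • g'` is orthogonal to `g'`
  -- and contributes nothing, leaving `t` times the square moment.
  set t : ℝ := inner ℝ g' w' / ‖g'‖ ^ 2 with ht
  by_cases h0 : g' = 0
  · have h1 : ∀ r : Fin m → Vec d, inner ℝ g (signDir g k r) = (0 : ℝ) := fun r => by
      rw [← inner_priorResidual_signDir, ← hg', h0, inner_zero_left]
    simp [h1, h0]
  have hn : ‖g'‖ ^ 2 ≠ 0 := by simpa using h0
  have hz : ∀ i, inner ℝ (k i) (w' - t • g') = 0 := fun i => by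
    rw [inner_sub_right, inner_smul_right, inner_priorResidual_left hk,
      inner_priorResidual_left hk, mul_zero, sub_zero]
  have hgz : inner ℝ g' (w' - t • g') = 0 := by
    rw [inner_sub_right, inner_smul_right, real_inner_self_eq_norm_sq, ht, div_mul_cancel₀ _ hn,
      sub_self]
  have h1 := integral_inner_signDir_mul_eq_zero (m := m) hz hgz
  have h2 : ∀ r : Fin m → Vec d, inner ℝ g' (signDir g' k r) *
      inner ℝ (w' - t • g') (signDir g' k r) =
      inner ℝ g (signDir g k r) * inner ℝ w (signDir g k r) -
        t * inner ℝ g (signDir g k r) ^ 2 := fun r => by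
    rw [inner_sub_left, inner_smul_left, inner_priorResidual_signDir, inner_priorResidual_signDir,
      conj_trivial]
    ring
  simp_rw [h2] at h1
  have hi := integrable_inner_signDir_mul (m := m) g g g k
  simp_rw [← sq] at hi
  rw [integral_sub (integrable_inner_signDir_mul g w g k) (hi.const_mul t), integral_const_mul,
    integral_inner_signDir_sq hk hm hsm, sub_eq_zero, ← hg'] at h1
  rw [h1, ht]
  field_simp

end Integral

end Gaussian

/-! ### The constant `a`. -/

section SignConst

variable {d q s : ℕ}

lemma signConst_eq (hsq : s < q) :
    (1 + (((q - s : ℕ) : ℝ) - 1) * (2 / Real.pi)) / (d - s) = signConst d q s := by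
  rw [signConst, Nat.cast_sub hsq.le]
  have := Real.pi_ne_zero
  rw [mul_comm _ Real.pi, ← div_div]
  congr 1
  field_simp
  ring

lemma signConst_pos (hsq : s < q) (hqd : q ≤ d) : 0 < signConst d q s := by
  have h1 : (s : ℝ) + 1 ≤ q := by exact_mod_cast hsq
  have h2 : (q : ℝ) ≤ d := by exact_mod_cast hqd
  exact div_pos (by linarith [Real.pi_pos]) (mul_pos (by linarith) Real.pi_pos)

lemma signConst_le_one (hsq : s < q) (hqd : q ≤ d) : signConst d q s ≤ 1 := by
  have h1 : (s : ℝ) + 1 ≤ q := by exact_mod_cast hsq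
  have h2 : (q : ℝ) ≤ d := by exact_mod_cast hqd
  have h3 := Real.pi_gt_three
  refine div_le_one_of_le₀ ?_ (mul_nonneg (by linarith) Real.pi_pos.le)
  nlinarith

lemma inv_signConst (hsq : s < q) :
    ((d : ℝ) - s) / (2 / Real.pi * ((q : ℝ) - s - 1) + 1) = (signConst d q s)⁻¹ := by
  rw [← signConst_eq hsq, inv_div, Nat.cast_sub hsq.le]
  congr 1
  ring

end SignConst

/-! ### Pathwise bounds for the two updates. -/

section Estimators

variable {d s m : ℕ}

lemma norm_smul_signDir_add_priorPart_sq_le (c : ℝ) (g : Vec d) (k : Fin s → Vec d)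
    (r : Fin m → Vec d) :
    ‖c • signDir g k r + priorPart g k r‖ ^ 2 ≤ c ^ 2 + ∑ i, inner ℝ g (priorDir k r i) ^ 2 := by
  have h1 : inner ℝ (c • signDir g k r) (priorPart g k r) = (0 : ℝ) := by
    simp [priorPart, inner_sum, inner_smul_left, inner_smul_right,
      real_inner_comm _ (signDir g k r), inner_priorDir_signDir]
  have h2 : ‖c • signDir g k r‖ ^ 2 ≤ c ^ 2 := by
    rw [norm_smul, mul_pow, Real.norm_eq_abs, sq_abs]
    exact mul_le_of_le_one_right (sq_nonneg c)
      (pow_le_one₀ (norm_nonneg _) (norm_signDir_le g k r))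
  have h3 := norm_sum_smul_sq_le (inner_priorDir_of_ne k r) (norm_priorDir_le k r)
    fun i => inner ℝ g (priorDir k r i)
  rw [norm_add_sq_real, h1]
  unfold priorPart
  linarith

lemma inner_priorPart (w g : Vec d) (k : Fin s → Vec d) (r : Fin m → Vec d) :
    inner ℝ w (priorPart g k r) =
      ∑ i, inner ℝ g (priorDir k r i) * inner ℝ w (priorDir k r i) := by
  simp [priorPart, inner_sum, inner_smul_right]

/-- The estimator satisfies `‖g₁‖² ≤ ⟪g, g₁⟫`, so a step of length `1 / L` keeps at least half of
the linear decrease. -/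
lemma IsSmooth.sub_gradEst₁_le {f : Vec d → ℝ} {L : ℝ} (hf : IsSmooth f L) (hL : 0 < L)
    (x : Vec d) (k : Fin s → Vec d) (r : Fin m → Vec d) :
    f (x - (1 / L) • gradEst₁ (gradient f x) k r) ≤ f x - 1 / (2 * L) *
      (inner ℝ (gradient f x) (signDir (gradient f x) k r) ^ 2 +
        ∑ i, inner ℝ (gradient f x) (priorDir k r i) ^ 2) := by
  set g := gradient f x with hg
  have h1 := hf.le_add_inner_add x (-((1 / L) • gradEst₁ g k r))
  rw [← sub_eq_add_neg, norm_neg, inner_neg_right, inner_smul_right, norm_smul, ← hg,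
    Real.norm_of_nonneg (by positivity)] at h1
  have h2 : inner ℝ g (gradEst₁ g k r) = inner ℝ g (signDir g k r) ^ 2 +
      ∑ i, inner ℝ g (priorDir k r i) ^ 2 := by
    rw [gradEst₁, inner_add_right, inner_smul_right, inner_priorPart]
    simp_rw [sq]
  have h3 := norm_smul_signDir_add_priorPart_sq_le (inner ℝ g (signDir g k r)) g k r
  rw [← gradEst₁] at h3
  rw [h2] at h1
  generalize inner ℝ g (signDir g k r) ^ 2 + ∑ i, inner ℝ g (priorDir k r i) ^ 2 = A at *
  have h4 : L / 2 * (1 / L * ‖gradEst₁ g k r‖) ^ 2 ≤ 1 / (2 * L) * A := by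
    have : L / 2 * (1 / L * ‖gradEst₁ g k r‖) ^ 2 = 1 / (2 * L) * ‖gradEst₁ g k r‖ ^ 2 := by
      field_simp
    rw [this]
    gcongr
  have h5 : 1 / (2 * L) * A = 1 / L * A - 1 / (2 * L) * A := by
    field_simp
    ring
  linarith

lemma gradEst₂_eq {q : ℕ} (hsq : s < q) (g : Vec d) (k : Fin s → Vec d) (r : Fin m → Vec d) :
    gradEst₂ q g k r = ((signConst d q s)⁻¹ * inner ℝ g (signDir g k r)) • signDir g k r +
      priorPart g k r := by
  rw [gradEst₂, inv_signConst hsq]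

lemma norm_sub_smul_gradEst₂_sq_le {q : ℕ} (hsq : s < q) (β : ℝ) (w g : Vec d)
    (k : Fin s → Vec d) (r : Fin m → Vec d) :
    ‖w - β • gradEst₂ q g k r‖ ^ 2 ≤ ‖w‖ ^ 2 - 2 * β * ((signConst d q s)⁻¹ *
        (inner ℝ g (signDir g k r) * inner ℝ w (signDir g k r)) +
        ∑ i, inner ℝ g (priorDir k r i) * inner ℝ w (priorDir k r i)) +
      β ^ 2 * ((signConst d q s)⁻¹ ^ 2 * inner ℝ g (signDir g k r) ^ 2 +
        ∑ i, inner ℝ g (priorDir k r i) ^ 2) := by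
  have h1 := norm_smul_signDir_add_priorPart_sq_le
    ((signConst d q s)⁻¹ * inner ℝ g (signDir g k r)) g k r
  rw [← gradEst₂_eq hsq, mul_pow] at h1
  have h2 : inner ℝ w (gradEst₂ q g k r) = (signConst d q s)⁻¹ *
      (inner ℝ g (signDir g k r) * inner ℝ w (signDir g k r)) +
      ∑ i, inner ℝ g (priorDir k r i) * inner ℝ w (priorDir k r i) := by
    rw [gradEst₂_eq hsq, inner_add_right, inner_smul_right, inner_priorPart]
    ring
  rw [norm_sub_sq_real, inner_smul_right, h2, norm_smul, mul_pow, Real.norm_eq_abs, sq_abs]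
  nlinarith [mul_le_mul_of_nonneg_left h1 (sq_nonneg β)]

end Estimators

/-! ### Consequences of the step-size rule. -/

section StepSize

variable {d q s m : ℕ}

lemma priorQuality_nonneg (g : Vec d) (k : Fin s → Vec d) (r : Fin m → Vec d) :
    0 ≤ priorQuality g k r := by
  unfold priorQuality
  positivity

lemma priorQuality_le_one (g : Vec d) (k : Fin s → Vec d) (r : Fin m → Vec d) :
    priorQuality g k r ≤ 1 :=
  div_le_one_of_le₀ (sum_inner_priorDir_sq_le g k r) (by positivity)

lemma add_mul_one_sub_pos {a D : ℝ} (ha : 0 < a) (h0 : 0 ≤ D) (h1 : D ≤ 1) :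
    0 < D + a * (1 - D) := by
  rcases h0.eq_or_lt with rfl | h0
  · simpa using ha
  · have := mul_nonneg ha.le (sub_nonneg.2 h1)
    linarith

lemma sq_signConst_div_le_stepSize {Lhat D : ℝ} (hsq : s < q) (hqd : q ≤ d) (hL : 0 < Lhat)
    (h0 : 0 ≤ D) (h1 : D ≤ 1) : signConst d q s ^ 2 / Lhat ≤ stepSize Lhat d q s D := by
  have ha := signConst_pos hsq hqd
  have ha1 := signConst_le_one hsq hqd
  have hpos := add_mul_one_sub_pos (inv_pos.2 ha) h0 h1
  rw [stepSize]
  generalize signConst d q s = a at *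
  rw [div_le_div_iff₀ hL (mul_pos hL hpos)]
  have h2 : a ^ 2 * (D + a⁻¹ * (1 - D)) = a ^ 2 * D + a * (1 - D) := by
    field_simp
  have h3 : a ^ 2 * D ≤ D := mul_le_of_le_one_left h0 (pow_le_one₀ ha.le ha1)
  nlinarith

/-- The step-size cap with denominators cleared and multiplied by `‖g‖²`: `ζ` times the
second-moment bound for `g₂` is at most twice the guaranteed expected decrease of `f`. -/
lemma mul_le_of_le_stepSize {Lhat ζ : ℝ} (hsq : s < q) (hqd : q ≤ d) (hL : 0 < Lhat)
    {g : Vec d} {k : Fin s → Vec d} {r : Fin m → Vec d}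
    (hζ : ζ ≤ stepSize Lhat d q s (priorQuality g k r)) :
    ζ * ((signConst d q s)⁻¹ * (‖g‖ ^ 2 - ∑ i, inner ℝ g (priorDir k r i) ^ 2) +
        ∑ i, inner ℝ g (priorDir k r i) ^ 2) ≤
      1 / Lhat * (signConst d q s * (‖g‖ ^ 2 - ∑ i, inner ℝ g (priorDir k r i) ^ 2) +
        ∑ i, inner ℝ g (priorDir k r i) ^ 2) := by
  have ha := signConst_pos hsq hqd
  have h0 := priorQuality_nonneg g k r
  have h1 := priorQuality_le_one g k r
  have hS : ∑ i, inner ℝ g (priorDir k r i) ^ 2 = priorQuality g k r * ‖g‖ ^ 2 := by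
    by_cases hg : g = 0
    · simp [hg]
    · rw [priorQuality, div_mul_cancel₀]
      simpa using hg
  rw [hS]
  generalize priorQuality g k r = D at *
  have hpos := add_mul_one_sub_pos (inv_pos.2 ha) h0 h1
  rw [stepSize, le_div_iff₀ (mul_pos hL hpos)] at hζ
  have h2 : ζ * (D + (signConst d q s)⁻¹ * (1 - D)) ≤
      1 / Lhat * (D + signConst d q s * (1 - D)) := by
    rw [one_div_mul_eq_div, le_div_iff₀ hL]
    linarith
  nlinarith [mul_le_mul_of_nonneg_right h2 (sq_nonneg ‖g‖)]

end StepSize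

/-! ### Expected decrease of the potential in one step. -/

section OneStep

variable {d q s : ℕ} {f : Vec d → ℝ} {Lhat : ℝ}

/-- The Lyapunov function `(f θ - f⋆) / γ + ‖m - θ⋆‖² / 2` of the accelerated scheme. -/
def potential (f : Vec d → ℝ) (θstar : Vec d) (γ : ℝ) (θ m : Vec d) : ℝ :=
  (f θ - f θstar) / γ + 1 / 2 * ‖m - θstar‖ ^ 2

lemma potential_nonneg {θstar : Vec d} (hstar : ∀ y, f θstar ≤ f y) {γ : ℝ} (hγ : 0 < γ)
    (θ m : Vec d) : 0 ≤ potential f θstar γ θ m := by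
  have := sub_nonneg.2 (hstar θ)
  unfold potential
  positivity

/-- The potential after one step, as a function of the random vectors. -/
def nextPotential (f : Vec d → ℝ) (θstar : Vec d) (Lhat : ℝ) (q : ℕ) (x m : Vec d) (β γ' : ℝ)
    (k : Fin s → Vec d) (r : Fin (q - s) → Vec d) : ℝ :=
  potential f θstar γ' (x - (1 / Lhat) • gradEst₁ (gradient f x) k r)
    (m - β • gradEst₂ q (gradient f x) k r)

lemma lintegral_nextPotential_le_of_linearIndependent (hf : IsSmooth f Lhat) (hL : 0 < Lhat)
    (hsq : s < q) (hqd : q ≤ d) {θstar : Vec d} (hstar : ∀ y, f θstar ≤ f y) {k : Fin s → Vec d}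
    (hk : LinearIndependent ℝ k) (x m : Vec d) (β : ℝ) {γ' : ℝ} (hγ' : 0 < γ') :
    ∫⁻ r, ENNReal.ofReal (nextPotential f θstar Lhat q x m β γ' k r)
        ∂(gaussianVectors d (q - s)) ≤
      ENNReal.ofReal ((f x - 1 / (2 * Lhat) * (signConst d q s *
          ‖priorResidual k (gradient f x)‖ ^ 2 +
          ∑ i, inner ℝ (gradient f x) (gramSchmidtNormed ℝ k i) ^ 2) - f θstar) / γ' +
        1 / 2 * (‖m - θstar‖ ^ 2 - 2 * β * inner ℝ (gradient f x) (m - θstar) +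
          β ^ 2 * ((signConst d q s)⁻¹ * ‖priorResidual k (gradient f x)‖ ^ 2 +
            ∑ i, inner ℝ (gradient f x) (gramSchmidtNormed ℝ k i) ^ 2))) := by
  set g := gradient f x with hg
  set w := m - θstar with hw
  set S := ∑ i, inner ℝ g (gramSchmidtNormed ℝ k i) ^ 2 with hS
  set C := ∑ i, inner ℝ g (gramSchmidtNormed ℝ k i) * inner ℝ w (gramSchmidtNormed ℝ k i) with hC
  have ha := signConst_pos hsq hqd
  set a := signConst d q s with haa
  set P := gaussianVectors d (q - s) with hP
  have hm : 0 < q - s := by omega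
  have hsm : s + (q - s) ≤ d := by omega
  let V : (Fin (q - s) → Vec d) → ℝ := fun r => inner ℝ g (signDir g k r) ^ 2
  let W : (Fin (q - s) → Vec d) → ℝ :=
    fun r => inner ℝ g (signDir g k r) * inner ℝ w (signDir g k r)
  have hVi : Integrable V P := by
    have := integrable_inner_signDir_mul (m := q - s) g g g k
    simp_rw [← sq] at this
    exact this
  have hWi : Integrable W P := integrable_inner_signDir_mul g w g k
  have hVint : ∫ r, V r ∂P = a * ‖priorResidual k g‖ ^ 2 := by
    rw [haa, ← signConst_eq hsq]
    exact integral_inner_signDir_sq hk hm hsm g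
  have hWint : ∫ r, W r ∂P = a * (inner ℝ g w - C) := by
    rw [haa, ← signConst_eq hsq, hC, ← inner_priorResidual_priorResidual hk]
    exact integral_inner_signDir_mul hk hm hsm g w
  let c₀ : ℝ := (f x - 1 / (2 * Lhat) * S - f θstar) / γ' +
    1 / 2 * (‖w‖ ^ 2 - 2 * β * C + β ^ 2 * S)
  let cV : ℝ := -(1 / (2 * Lhat)) / γ' + 1 / 2 * (β ^ 2 * a⁻¹ ^ 2)
  let cW : ℝ := -(β * a⁻¹)
  -- The pathwise bound is affine in the two random quantities whose means are known, so it can be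
  -- integrated exactly.
  have hle : ∀ r, nextPotential f θstar Lhat q x m β γ' k r ≤ c₀ + cV * V r + cW * W r := by
    intro r
    have h1 := hf.sub_gradEst₁_le hL x k r
    have h2 := norm_sub_smul_gradEst₂_sq_le hsq β w g k r
    simp_rw [priorDir_eq, ← hg] at h1 h2
    rw [← hS] at h1 h2
    rw [← hC] at h2
    have h3 : m - β • gradEst₂ q g k r - θstar = w - β • gradEst₂ q g k r := by
      rw [hw]; abel
    rw [nextPotential, potential, ← hg, h3]
    have h4 : (f (x - (1 / Lhat) • gradEst₁ g k r) - f θstar) / γ' ≤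
        (f x - 1 / (2 * Lhat) * (V r + S) - f θstar) / γ' := by
      gcongr
    have h5 : (f x - 1 / (2 * Lhat) * (V r + S) - f θstar) / γ' =
        (f x - 1 / (2 * Lhat) * S - f θstar) / γ' + -(1 / (2 * Lhat)) / γ' * V r := by
      ring
    simp only [c₀, cV, cW]
    change _ ≤ _ - 2 * β * (a⁻¹ * W r + C) + β ^ 2 * (a⁻¹ ^ 2 * V r + S) at h2
    linarith
  have hi₁ : Integrable (fun r => c₀ + cV * V r) P := (integrable_const c₀).add (hVi.const_mul cV)
  have hi : Integrable (fun r => c₀ + cV * V r + cW * W r) P := hi₁.add (hWi.const_mul cW)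
  have hnn : ∀ r, 0 ≤ c₀ + cV * V r + cW * W r := fun r =>
    (potential_nonneg hstar hγ' _ _).trans (hle r)
  refine (lintegral_mono fun r => ENNReal.ofReal_le_ofReal (hle r)).trans ?_
  rw [← ofReal_integral_eq_lintegral_ofReal hi (ae_of_all _ hnn)]
  refine ENNReal.ofReal_le_ofReal (le_of_eq ?_)
  rw [integral_add hi₁ (hWi.const_mul cW),
    integral_add (integrable_const c₀) (hVi.const_mul cV), integral_const_mul, integral_const_mul,
    hVint, hWint]
  simp only [c₀, cV, cW, integral_const, probReal_univ, one_smul]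
  field_simp
  ring

/-- The vectors `r₀` stand for the actual draw, through which the step-size cap is stated. They drop
out by `priorDir_eq`, so `ζ` may stay fixed while `r` is integrated. -/
lemma lintegral_nextPotential_le (hf : IsSmooth f Lhat) (hconv : ConvexOn ℝ Set.univ f)
    (hL : 0 < Lhat) (hsq : s < q) (hqd : q ≤ d) {θstar : Vec d} (hstar : ∀ y, f θstar ≤ f y)
    {k : Fin s → Vec d} (hk : LinearIndependent ℝ k) {θ x m : Vec d} {α γ ζ : ℝ} (hγ : 0 < γ)
    (hα : 0 < α) (hα1 : α < 1) (hroot : α ^ 2 = ζ * γ * (1 - α))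
    (hx : x = (1 - α) • θ + α • m) {r₀ : Fin (q - s) → Vec d}
    (hζ : ζ ≤ stepSize Lhat d q s (priorQuality (gradient f x) k r₀)) :
    ∫⁻ r, ENNReal.ofReal (nextPotential f θstar Lhat q x m (ζ / α) ((1 - α) * γ) k r)
        ∂(gaussianVectors d (q - s)) ≤ ENNReal.ofReal (potential f θstar γ θ m) := by
  have hγ' : 0 < (1 - α) * γ := mul_pos (by linarith) hγ
  refine (lintegral_nextPotential_le_of_linearIndependent hf hL hsq hqd hstar hk x m
    (ζ / α) hγ').trans
    (ENNReal.ofReal_le_ofReal ?_)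
  have h1 := mul_le_of_le_stepSize hsq hqd hL hζ
  simp_rw [priorDir_eq, ← norm_priorResidual_sq hk] at h1
  set g := gradient f x with hg
  set S := ∑ i, inner ℝ g (gramSchmidtNormed ℝ k i) ^ 2
  set ρ := ‖priorResidual k g‖ ^ 2
  set a := signConst d q s
  have h2 := inner_gradient_le_sub hf.1 hconv x θ
  have h3 := inner_gradient_le_sub hf.1 hconv x θstar
  rw [← hg] at h2 h3
  -- Since `x` interpolates `θ` and `m`, the linear term splits into the two directions in which
  -- convexity is applied.
  have h4 : α * inner ℝ g (m - θstar) =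
      -((1 - α) * inner ℝ g (θ - x)) - α * inner ℝ g (θstar - x) := by
    rw [← inner_smul_right, ← inner_smul_right, ← inner_smul_right, ← inner_neg_right,
      ← inner_sub_right]
    congr 1
    rw [hx]
    module
  -- The equation for `α` puts the linear and quadratic terms over the common denominator `(1 - α) *
  -- γ`, the next `γ`.
  have hβ : ζ / α = α / ((1 - α) * γ) := by
    rw [div_eq_div_iff hα.ne' hγ'.ne']
    linarith
  have hβ2 : (ζ / α) ^ 2 = ζ / ((1 - α) * γ) := by
    rw [div_pow, div_eq_div_iff (pow_ne_zero 2 hα.ne') hγ'.ne', hroot]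
    ring
  rw [hβ2, hβ, potential]
  have h5 : (f θ - f θstar) / γ = (1 - α) * (f θ - f θstar) / ((1 - α) * γ) := by
    rw [mul_div_mul_left _ _ (by linarith : (1 - α) ≠ 0)]
  rw [h5]
  have h6 : (f x - 1 / (2 * Lhat) * (a * ρ + S) - f θstar) / ((1 - α) * γ) +
      1 / 2 * (‖m - θstar‖ ^ 2 - 2 * (α / ((1 - α) * γ)) * inner ℝ g (m - θstar) +
        ζ / ((1 - α) * γ) * (a⁻¹ * ρ + S)) =
      (f x - f θstar - α * inner ℝ g (m - θstar) +
        1 / 2 * (ζ * (a⁻¹ * ρ + S) - 1 / Lhat * (a * ρ + S))) / ((1 - α) * γ) +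
      1 / 2 * ‖m - θstar‖ ^ 2 := by
    ring
  rw [h6]
  gcongr
  nlinarith [mul_le_mul_of_nonneg_left h2 (by linarith : 0 ≤ 1 - α),
    mul_le_mul_of_nonneg_left h3 hα.le]

end OneStep

/-- Freezing: by independence the joint law is a product, so `Y` can be integrated out first with
`X` held fixed. -/
lemma lintegral_comp_prodMk_of_indepFun {Ω A B : Type*} {mΩ : MeasurableSpace Ω}
    [MeasurableSpace A] [MeasurableSpace B] {μ : Measure Ω} [IsProbabilityMeasure μ] {X : Ω → A}
    {Y : Ω → B} (h : IndepFun X Y μ) (hX : Measurable X) (hY : Measurable Y)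
    {F : A → B → ENNReal} (hF : Measurable fun p : A × B => F p.1 p.2) :
    ∫⁻ ω, F (X ω) (Y ω) ∂μ = ∫⁻ ω, ∫⁻ y, F (X ω) y ∂(μ.map Y) ∂μ := by
  have := Measure.isProbabilityMeasure_map (μ := μ) hY.aemeasurable
  rw [← lintegral_map (f := fun p : A × B => F p.1 p.2) hF (hX.prodMk hY),
    (indepFun_iff_map_prod_eq_prod_map_map hX.aemeasurable hY.aemeasurable).1 h,
    lintegral_prod _ hF.aemeasurable,
    lintegral_map (f := fun x => ∫⁻ y, F x y ∂(μ.map Y)) hF.lintegral_prod_right' hX]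

/-! ### The interpolation coefficient and the growth of `1/√γ`. -/

section Coefficient

/-- A run specifies `α` only through its equation; the quadratic formula for the positive root
recovers measurability. -/
lemma measurable_of_sq_eq_mul_one_sub {X : Type*} {mX : MeasurableSpace X} {b α : X → ℝ}
    (hb : Measurable b) (hb0 : ∀ x, 0 < b x) (hα : ∀ x, 0 < α x)
    (hroot : ∀ x, α x ^ 2 = b x * (1 - α x)) : Measurable α := by
  have h : α = fun x => (√(b x ^ 2 + 4 * b x) - b x) / 2 := by
    ext x
    have h1 : b x ^ 2 + 4 * b x = (2 * α x + b x) ^ 2 := by linarith [hroot x]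
    rw [h1, Real.sqrt_sq (by linarith [hb0 x, hα x])]
    ring
  rw [h]
  fun_prop

lemma lt_one_of_sq_eq_mul_one_sub {b α : ℝ} (hb0 : 0 < b) (hα : 0 < α)
    (hroot : α ^ 2 = b * (1 - α)) : α < 1 := by
  by_contra! h
  nlinarith [pow_pos hα 2]

/-- With `v = √(1 - α)` the claim reduces to `v + α / 2 ≤ 1`, that is, `(1 - v)² ≥ 0`. -/
lemma inv_sqrt_add_le {α γ ζ : ℝ} (hγ : 0 < γ) (hα : 0 < α) (hα1 : α < 1)
    (hroot : α ^ 2 = ζ * γ * (1 - α)) :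
    1 / √γ + 1 / 2 * √ζ ≤ 1 / √((1 - α) * γ) := by
  have h1 : 0 < 1 - α := by linarith
  have hζ : ζ = α ^ 2 / ((1 - α) * γ) := by
    rw [eq_div_iff (mul_pos h1 hγ).ne', hroot]
    ring
  rw [hζ, Real.sqrt_div (sq_nonneg α), Real.sqrt_sq hα.le, Real.sqrt_mul h1.le]
  have hu : 0 < √γ := Real.sqrt_pos.2 hγ
  have hv : 0 < √(1 - α) := Real.sqrt_pos.2 h1
  have hvv := Real.sq_sqrt h1.le
  generalize √γ = u at *
  generalize √(1 - α) = v at *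
  have h2 : 1 / u + 1 / 2 * (α / (v * u)) = (v + α / 2) / (v * u) := by
    field_simp
  rw [h2]
  gcongr
  nlinarith [sq_nonneg (1 - v)]

end Coefficient

lemma measurable_nextPotential {X : Type*} {mX : MeasurableSpace X} {d q s : ℕ}
    {f : Vec d → ℝ} {L : ℝ} (hf : IsSmooth f L) (θstar : Vec d) (Lhat : ℝ) {x m : X → Vec d}
    {β γ' : X → ℝ} {k : X → Fin s → Vec d} {r : X → Fin (q - s) → Vec d}
    (hx : Measurable x) (hm : Measurable m) (hβ : Measurable β) (hγ' : Measurable γ')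
    (hk : Measurable k) (hr : Measurable r) :
    Measurable fun y => nextPotential f θstar Lhat q (x y) (m y) (β y) (γ' y) (k y) (r y) := by
  have hg : Measurable fun y => gradient f (x y) := hf.continuous_gradient.measurable.comp hx
  have h1 := measurable_gradEst₁ hg hk hr
  have h2 := measurable_gradEst₂ q hg hk hr
  have hfm := hf.1.continuous.measurable
  unfold nextPotential potential
  exact (((hfm.comp (hx.sub (h1.const_smul (1 / Lhat)))).sub_const _).div hγ').add
    ((((hm.sub (hβ.smul h2)).sub_const θstar).norm.pow_const 2).const_mul _)

/-! ### Adaptedness of the run and the supermartingale-type estimate. -/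

namespace IdealizedRun

variable {d : ℕ} {Ω : Type*} {mΩ : MeasurableSpace Ω} {μ : Measure Ω} {f : Vec d → ℝ}
  {L Lhat γ₀ : ℝ} {θ₀ θstar : Vec d} {q s T : ℕ} (R : IdealizedRun μ f θ₀ Lhat γ₀ q s T)

lemma γ_pos (hγ₀ : 0 < γ₀) {t : ℕ} (ht : t ≤ T) (ω : Ω) : 0 < R.γ t ω := by
  induction t with
  | zero => rwa [R.γ_zero]
  | succ t ih =>
    have hγ := ih (by omega)
    have h := lt_one_of_sq_eq_mul_one_sub (mul_pos (R.ζ_pos t ht ω) hγ) (R.α_pos t ht ω)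
      (R.α_root t ht ω)
    rw [R.γ_succ t ht]
    exact mul_pos (by linarith) hγ

lemma α_lt_one (hγ₀ : 0 < γ₀) {t : ℕ} (ht : t < T) (ω : Ω) : R.α t ω < 1 :=
  lt_one_of_sq_eq_mul_one_sub (mul_pos (R.ζ_pos t ht ω) (R.γ_pos hγ₀ ht.le ω)) (R.α_pos t ht ω)
    (R.α_root t ht ω)

lemma inv_sqrt_γ_ge (hγ₀ : 0 < γ₀) {t : ℕ} (ht : t ≤ T) (ω : Ω) :
    1 / √γ₀ + 1 / 2 * ∑ i ∈ Finset.range t, √(R.ζ i ω) ≤ 1 / √(R.γ t ω) := by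
  induction t with
  | zero => simp [R.γ_zero]
  | succ t ih =>
    have h := inv_sqrt_add_le (R.γ_pos hγ₀ (by omega) ω) (R.α_pos t ht ω) (R.α_lt_one hγ₀ ht ω)
      (R.α_root t ht ω)
    rw [Finset.sum_range_succ, R.γ_succ t ht]
    linarith [ih (by omega)]

lemma one_add_sum_sq_le (hγ₀ : 0 < γ₀) (ω : Ω) :
    (1 + √γ₀ / 2 * ∑ t ∈ Finset.range T, √(R.ζ t ω)) ^ 2 ≤ γ₀ / R.γ T ω := by
  have hu : 0 < √γ₀ := Real.sqrt_pos.2 hγ₀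
  have h := mul_le_mul_of_nonneg_left (R.inv_sqrt_γ_ge hγ₀ le_rfl ω) hu.le
  have h2 : γ₀ / R.γ T ω = (√γ₀ / √(R.γ T ω)) ^ 2 := by
    rw [div_pow, Real.sq_sqrt hγ₀.le, Real.sq_sqrt (R.γ_pos hγ₀ le_rfl ω).le]
  rw [h2]
  refine pow_le_pow_left₀ (by positivity) (le_trans (le_of_eq ?_) (h.trans (le_of_eq ?_))) 2
  · field_simp
  · rw [mul_one_div]

lemma measurable_α_of_measurable_γ (hγ₀ : 0 < γ₀) {t : ℕ} (ht : t < T)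
    (hγ : Measurable[R.ℱ t] (R.γ t)) : Measurable[R.ℱ t] (R.α t) :=
  measurable_of_sq_eq_mul_one_sub ((R.ζ_measurable t ht).mul hγ)
    (fun ω => mul_pos (R.ζ_pos t ht ω) (R.γ_pos hγ₀ ht.le ω)) (R.α_pos t ht) (R.α_root t ht)

lemma measurable_θtilde_of {X : MeasurableSpace Ω} {t : ℕ} (ht : t < T)
    (hα : Measurable[X] (R.α t)) (hθ : Measurable[X] (R.θ t)) (hm : Measurable[X] (R.m t)) :
    Measurable[X] (R.θtilde t) := by
  rw [funext (R.θtilde_eq t ht)]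
  exact ((hα.const_sub 1).smul hθ).add (hα.smul hm)

lemma measurable_state (hf : IsSmooth f L) (hγ₀ : 0 < γ₀) {t : ℕ} (ht : t ≤ T) :
    Measurable[R.ℱ t] (R.θ t) ∧ Measurable[R.ℱ t] (R.m t) ∧ Measurable[R.ℱ t] (R.γ t) := by
  induction t with
  | zero =>
    rw [funext R.θ_zero, funext R.m_zero, funext R.γ_zero]
    exact ⟨measurable_const, measurable_const, measurable_const⟩
  | succ t ih =>
    obtain ⟨hθ, hm, hγ⟩ := ih (by omega)
    have hle : R.ℱ t ≤ R.ℱ (t + 1) := R.ℱ.mono (Nat.le_succ t)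
    have hα := R.measurable_α_of_measurable_γ hγ₀ ht hγ
    have hx := R.measurable_θtilde_of ht hα hθ hm
    have hα' := hα.mono hle le_rfl
    have hζ' := (R.ζ_measurable t ht).mono hle le_rfl
    have hx' := hx.mono hle le_rfl
    have hg := hf.continuous_gradient.measurable.comp hx'
    have hk := (R.k_measurable t ht).mono hle le_rfl
    have hr := R.r_measurable t ht
    refine ⟨?_, ?_, ?_⟩
    · rw [funext (R.θ_succ t ht)]
      exact hx'.sub ((measurable_gradEst₁ hg hk hr).const_smul (1 / Lhat))
    · rw [funext (R.m_succ t ht)]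
      exact (hm.mono hle le_rfl).sub ((hζ'.div hα').smul (measurable_gradEst₂ q hg hk hr))
    · rw [funext (R.γ_succ t ht)]
      exact (hα'.const_sub 1).mul (hγ.mono hle le_rfl)

lemma potential_succ {t : ℕ} (ht : t < T) (ω : Ω) :
    potential f θstar (R.γ (t + 1) ω) (R.θ (t + 1) ω) (R.m (t + 1) ω) =
      nextPotential f θstar Lhat q (R.θtilde t ω) (R.m t ω) (R.ζ t ω / R.α t ω)
        ((1 - R.α t ω) * R.γ t ω) (R.k t ω) (R.r t ω) := by
  rw [R.θ_succ t ht, R.m_succ t ht, R.γ_succ t ht, nextPotential]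

lemma lintegral_potential_succ_le [IsProbabilityMeasure μ] (hf : IsSmooth f Lhat)
    (hconv : ConvexOn ℝ Set.univ f) (hL : 0 < Lhat) (hγ₀ : 0 < γ₀) (hsq : s < q) (hqd : q ≤ d)
    (hstar : ∀ y, f θstar ≤ f y) {t : ℕ} (ht : t < T) :
    ∫⁻ ω, ENNReal.ofReal
        (potential f θstar (R.γ (t + 1) ω) (R.θ (t + 1) ω) (R.m (t + 1) ω)) ∂μ ≤
      ∫⁻ ω, ENNReal.ofReal (potential f θstar (R.γ t ω) (R.θ t ω) (R.m t ω)) ∂μ := by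
  obtain ⟨hθ, hm, hγ⟩ := R.measurable_state hf hγ₀ ht.le
  have hα := R.measurable_α_of_measurable_γ hγ₀ ht hγ
  have hx := R.measurable_θtilde_of ht hα hθ hm
  have hr : Measurable (R.r t) := (R.r_measurable t ht).mono (R.ℱ.le _) le_rfl
  -- Everything the next potential needs besides `r t`. It is `ℱ t`-measurable, hence independent of
  -- the draw.
  let X : Ω → Vec d × Vec d × ℝ × ℝ × (Fin s → Vec d) := fun ω =>
    (R.θtilde t ω, R.m t ω, R.ζ t ω / R.α t ω, (1 - R.α t ω) * R.γ t ω, R.k t ω)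
  have hX : Measurable[R.ℱ t] X := hx.prodMk (hm.prodMk (((R.ζ_measurable t ht).div hα).prodMk
    (((hα.const_sub 1).mul hγ).prodMk (R.k_measurable t ht))))
  have hind : IndepFun X (R.r t) μ :=
    (indep_of_indep_of_le_right (R.r_indep t ht) hX.comap_le).symm
  let F : Vec d × Vec d × ℝ × ℝ × (Fin s → Vec d) → (Fin (q - s) → Vec d) → ENNReal := fun p r =>
    ENNReal.ofReal (nextPotential f θstar Lhat q p.1 p.2.1 p.2.2.1 p.2.2.2.1 p.2.2.2.2 r)
  have hF : Measurable fun p : (Vec d × Vec d × ℝ × ℝ × (Fin s → Vec d)) ×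
      (Fin (q - s) → Vec d) => F p.1 p.2 :=
    (measurable_nextPotential hf θstar Lhat (by fun_prop) (by fun_prop) (by fun_prop)
      (by fun_prop) (by fun_prop) (by fun_prop)).ennreal_ofReal
  simp_rw [R.potential_succ ht]
  have h := lintegral_comp_prodMk_of_indepFun hind (hX.mono (R.ℱ.le t) le_rfl) hr hF
  refine h.le.trans (lintegral_mono_ae ?_)
  filter_upwards [R.k_linearIndependent t ht] with ω hk
  rw [R.r_law t ht]
  exact lintegral_nextPotential_le hf hconv hL hsq hqd hstar hk (R.γ_pos hγ₀ ht.le ω)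
    (R.α_pos t ht ω) (R.α_lt_one hγ₀ ht ω) (R.α_root t ht ω) (R.θtilde_eq t ht ω)
    (R.ζ_le t ht ω)

lemma lintegral_potential_le [IsProbabilityMeasure μ] (hf : IsSmooth f Lhat)
    (hconv : ConvexOn ℝ Set.univ f) (hL : 0 < Lhat) (hγ₀ : 0 < γ₀) (hsq : s < q) (hqd : q ≤ d)
    (hstar : ∀ y, f θstar ≤ f y) {t : ℕ} (ht : t ≤ T) :
    ∫⁻ ω, ENNReal.ofReal (potential f θstar (R.γ t ω) (R.θ t ω) (R.m t ω)) ∂μ ≤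
      ENNReal.ofReal (potential f θstar γ₀ θ₀ θ₀) := by
  induction t with
  | zero => simp [R.γ_zero, R.θ_zero, R.m_zero]
  | succ t ih =>
    exact (R.lintegral_potential_succ_le hf hconv hL hγ₀ hsq hqd hstar ht).trans (ih (by omega))

lemma measurable_weighted_gap (hf : IsSmooth f L) (hγ₀ : 0 < γ₀) :
    Measurable fun ω => (f (R.θ T ω) - f θstar) *
      (1 + √γ₀ / 2 * ∑ t ∈ Finset.range T, √(R.ζ t ω)) ^ 2 := by
  have hθ := (R.measurable_state hf hγ₀ le_rfl).1.mono (R.ℱ.le T) le_rfl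
  have hζ : Measurable fun ω => ∑ t ∈ Finset.range T, √(R.ζ t ω) :=
    Finset.measurable_sum _ fun t ht =>
      ((R.ζ_measurable t (Finset.mem_range.1 ht)).mono (R.ℱ.le t) le_rfl).sqrt
  exact ((hf.1.continuous.measurable.comp hθ).sub_const _).mul
    (((hζ.const_mul _).const_add 1).pow_const 2)

lemma lintegral_weighted_gap_le [IsProbabilityMeasure μ] (hf : IsSmooth f Lhat)
    (hconv : ConvexOn ℝ Set.univ f) (hL : 0 < Lhat) (hγ₀ : 0 < γ₀) (hsq : s < q) (hqd : q ≤ d)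
    (hstar : ∀ y, f θstar ≤ f y) :
    ∫⁻ ω, ENNReal.ofReal ((f (R.θ T ω) - f θstar) *
        (1 + √γ₀ / 2 * ∑ t ∈ Finset.range T, √(R.ζ t ω)) ^ 2) ∂μ ≤
      ENNReal.ofReal (f θ₀ - f θstar + γ₀ / 2 * ‖θ₀ - θstar‖ ^ 2) := by
  have h1 : ∀ ω, (f (R.θ T ω) - f θstar) *
      (1 + √γ₀ / 2 * ∑ t ∈ Finset.range T, √(R.ζ t ω)) ^ 2 ≤
      γ₀ * potential f θstar (R.γ T ω) (R.θ T ω) (R.m T ω) := fun ω => by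
    have h2 := mul_le_mul_of_nonneg_left (R.one_add_sum_sq_le hγ₀ ω)
      (sub_nonneg.2 (hstar (R.θ T ω)))
    have h3 : 0 ≤ γ₀ * (1 / 2 * ‖R.m T ω - θstar‖ ^ 2) := by positivity
    have h4 : (f (R.θ T ω) - f θstar) * (γ₀ / R.γ T ω) =
        γ₀ * ((f (R.θ T ω) - f θstar) / R.γ T ω) := by ring
    rw [potential, mul_add]
    linarith
  calc _ ≤ ∫⁻ ω, ENNReal.ofReal γ₀ *
        ENNReal.ofReal (potential f θstar (R.γ T ω) (R.θ T ω) (R.m T ω)) ∂μ :=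
      lintegral_mono fun ω => by
        rw [← ENNReal.ofReal_mul hγ₀.le]
        exact ENNReal.ofReal_le_ofReal (h1 ω)
    _ = ENNReal.ofReal γ₀ *
        ∫⁻ ω, ENNReal.ofReal (potential f θstar (R.γ T ω) (R.θ T ω) (R.m T ω)) ∂μ :=
      lintegral_const_mul' _ _ ENNReal.ofReal_ne_top
    _ ≤ ENNReal.ofReal γ₀ * ENNReal.ofReal (potential f θstar γ₀ θ₀ θ₀) := by
      gcongr
      exact R.lintegral_potential_le hf hconv hL hγ₀ hsq hqd hstar le_rfl
    _ = _ := by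
      rw [← ENNReal.ofReal_mul hγ₀.le, potential]
      congr 1
      field_simp

end IdealizedRun

lemma IsSmooth.mono {d : ℕ} {f : Vec d → ℝ} {L L' : ℝ} (hf : IsSmooth f L) (h : L ≤ L') :
    IsSmooth f L' :=
  ⟨hf.1, fun x y => (hf.2 x y).trans (by gcongr)⟩

end ARSOpt

end

/-! ### From the weighted estimate to integrability and the rate. -/

theorem theorem2 {d : ℕ} {Ω : Type*} {mΩ : MeasurableSpace Ω} (μ : Measure Ω)
    [IsProbabilityMeasure μ] (f : ARSOpt.Vec d → ℝ) (L Lhat γ₀ : ℝ) (θ₀ θstar : ARSOpt.Vec d)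
    (q s T : ℕ) (hsq : s < q) (hqd : q ≤ d)
    (hsmooth : ARSOpt.IsSmooth f L) (hconv : ConvexOn ℝ Set.univ f)
    (hL : L ≤ Lhat) (hLhat : 0 < Lhat) (hγ₀ : 0 < γ₀)
    (hstar : IsMinOn f {0}ᶜ θstar)
    (R : ARSOpt.IdealizedRun μ f θ₀ Lhat γ₀ q s T) :
    (Integrable (fun ω => (f (R.θ T ω) - f θstar) *
        (1 + Real.sqrt γ₀ / 2 * ∑ t ∈ Finset.range T, Real.sqrt (R.ζ t ω)) ^ 2) μ ∧
      ∫ ω, (f (R.θ T ω) - f θstar) *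
        (1 + Real.sqrt γ₀ / 2 * ∑ t ∈ Finset.range T, Real.sqrt (R.ζ t ω)) ^ 2 ∂μ
        ≤ f θ₀ - f θstar + γ₀ / 2 * ‖θ₀ - θstar‖ ^ 2) ∧
    (∀ t < T, ∀ ω, ARSOpt.signConst d q s ^ 2 / Lhat ≤
      ARSOpt.stepSize Lhat d q s
        (ARSOpt.priorQuality (gradient f (R.θtilde t ω)) (R.k t ω) (R.r t ω))) ∧
    (∀ c : ℝ, 0 < c → (∀ t < T, ∀ᵐ ω ∂μ, c ≤ R.ζ t ω) →
      Integrable (fun ω => f (R.θ T ω) - f θstar) μ ∧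
      ∫ ω, (f (R.θ T ω) - f θstar) ∂μ ≤
        (f θ₀ - f θstar + γ₀ / 2 * ‖θ₀ - θstar‖ ^ 2) /
          (1 + Real.sqrt γ₀ / 2 * (T * Real.sqrt c)) ^ 2) := by
  have hf := hsmooth.mono hL
  have hmin := ARSOpt.forall_le_of_isMinOn_compl_zero (by omega) hf.1.continuous hstar
  have hle := R.lintegral_weighted_gap_le hf hconv hLhat hγ₀ hsq hqd hmin
  have hmeas := R.measurable_weighted_gap (θstar := θstar) hf hγ₀
  have hgap : ∀ ω, 0 ≤ f (R.θ T ω) - f θstar := fun ω => sub_nonneg.2 (hmin _)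
  have hnn : ∀ ω, 0 ≤ (f (R.θ T ω) - f θstar) *
      (1 + Real.sqrt γ₀ / 2 * ∑ t ∈ Finset.range T, Real.sqrt (R.ζ t ω)) ^ 2 :=
    fun ω => mul_nonneg (hgap ω) (sq_nonneg _)
  have hint : Integrable (fun ω => (f (R.θ T ω) - f θstar) *
      (1 + Real.sqrt γ₀ / 2 * ∑ t ∈ Finset.range T, Real.sqrt (R.ζ t ω)) ^ 2) μ :=
    ⟨hmeas.aestronglyMeasurable, (hasFiniteIntegral_iff_ofReal (ae_of_all _ hnn)).2
      (hle.trans_lt ENNReal.ofReal_lt_top)⟩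
  have hbound : ∫ ω, (f (R.θ T ω) - f θstar) *
      (1 + Real.sqrt γ₀ / 2 * ∑ t ∈ Finset.range T, Real.sqrt (R.ζ t ω)) ^ 2 ∂μ
      ≤ f θ₀ - f θstar + γ₀ / 2 * ‖θ₀ - θstar‖ ^ 2 := by
    rw [integral_eq_lintegral_of_nonneg_ae (ae_of_all _ hnn) hmeas.aestronglyMeasurable]
    refine ENNReal.toReal_le_of_le_ofReal ?_ hle
    have := sub_nonneg.2 (hmin θ₀)
    positivity
  refine ⟨⟨hint, hbound⟩, fun t _ ω => ARSOpt.sq_signConst_div_le_stepSize hsq hqd hLhat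
    (ARSOpt.priorQuality_nonneg _ _ _) (ARSOpt.priorQuality_le_one _ _ _), fun c hc hζ => ?_⟩
  have hB : 0 < (1 + Real.sqrt γ₀ / 2 * (T * Real.sqrt c)) ^ 2 := by positivity
  -- If every `ζ t` is at least `c`, the random weight dominates the deterministic one, so the gap
  -- is controlled by the integrable weighted gap.
  have hae : ∀ᵐ ω ∂μ, f (R.θ T ω) - f θstar ≤ (f (R.θ T ω) - f θstar) *
      (1 + Real.sqrt γ₀ / 2 * ∑ t ∈ Finset.range T, Real.sqrt (R.ζ t ω)) ^ 2 /
      (1 + Real.sqrt γ₀ / 2 * (T * Real.sqrt c)) ^ 2 := by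
    filter_upwards [ae_all_iff.2 fun t => ae_all_iff.2 (hζ t)] with ω hω
    rw [le_div_iff₀ hB]
    refine mul_le_mul_of_nonneg_left (pow_le_pow_left₀ (by positivity) ?_ 2) (hgap ω)
    gcongr
    calc (T : ℝ) * Real.sqrt c = ∑ t ∈ Finset.range T, Real.sqrt c := by simp
      _ ≤ _ := Finset.sum_le_sum fun t ht => Real.sqrt_le_sqrt (hω t (Finset.mem_range.1 ht))
  have hmeas' : Measurable fun ω => f (R.θ T ω) - f θstar :=
    (hf.1.continuous.measurable.comp
      ((R.measurable_state hf hγ₀ le_rfl).1.mono (R.ℱ.le T) le_rfl)).sub_const _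
  have hint' := (hint.div_const ((1 + Real.sqrt γ₀ / 2 * (T * Real.sqrt c)) ^ 2)).mono'
    hmeas'.aestronglyMeasurable (hae.mono fun ω h => by rwa [Real.norm_of_nonneg (hgap ω)])
  refine ⟨hint', (integral_mono_ae hint' (hint.div_const _) hae).trans ?_⟩
  rw [integral_div]
  gcongr
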